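/- Conventions. $[\cdot,\cdot]$ is the Lie bracket, $d\alpha(X,Y)=\frac12\{X\alpha(Y)-Y\alpha(X)-\alpha([X,Y])\}$ and $(\alpha\wedge\beta)(X,Y)=\frac12\{\alpha(X)\beta(Y)-\alpha(Y)\beta(X)\}$ for one-forms, and $[A,A](X,Y)=A^2[X,Y]+[AX,AY]-A[AX,Y]-A[X,AY]$ for a $(1,1)$-tensor field $A$. Ambient manifold. Let $0<q<n$ be integers. Let $\overline M$ be a complex manifold of complex dimension $2n+1$ with complex structure $J$, and let $\{\mathcal O_i\}$ be an open cover of $\overline M$ with holomorphic one-forms $\theta_i$ on $\mathcal O_i$ such that $\theta_i\wedge(d\theta_i)^n\neq0$ everywhere on $\mathcal O_i$ and $\theta_i=f_{ij}\theta_j$ on $\mathcal O_i\cap\mathcal O_j$ with $f_{ij}$ holomorphic and nowhere zero (a complex contact manifold). Put $\mathcal H=\ker\theta_i$. Let $\overline g$ be a $J$-Hermitian semi-Riemannian metric on $\overline M$ of constant index $4q$, and suppose that on each $\mathcal O_i$ there are smooth real one-forms $u_i$, $v_i=u_i\circ J$, $\sigma_i$, smooth vector fields $U_i$, $V_i=-JU_i$,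 and smooth $(1,1)$-tensor fields $G_i$, $H_i=G_iJ$ with $$H_i^2=G_i^2=-I+u_i\otimes U_i+v_i\otimes V_i,\quad \overline g(G_iX,Y)=-\overline g(X,G_iY),\quad \overline g(U_i,X)=u_i(X),$$ $$G_iJ=-JG_i,\quad G_iU_i=0,\quad u_i(U_i)=1,$$ $$du_i(X,Y)=\overline g(X,G_iY)+(\sigma_i\wedge v_i)(X,Y),\qquad dv_i(X,Y)=\overline g(X,H_iY)-(\sigma_i\wedge u_i)(X,Y),$$ such that $\theta_i$ equals $u_i-\sqrt{-1}\,v_i$ up to a nowhere vanishing complex-valued factor, and on $\mathcal O_i\cap\mathcal O_j$ there are smooth functions $a,b$ with $a^2+b^2=1$, $u_j=au_i-bv_i$, $v_j=bu_i+av_i$, $G_j=aG_i-bH_i$, $H_j=bG_i+aH_i$. Assume that this structure is normal, i.e. (omitting the index $i$), for the tensors $$S(X,Y)=[G,G](X,Y)+2\overline g(X,GY)U-2\overline g(X,HY)V+2\{v(Y)HX-v(X)HY\}+\sigma(GY)HX-\sigma(GX)HY+\sigma(X)GHY-\sigma(Y)GHX,$$ $$T(X,Y)=[H,H](X,Y)-2\overline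 g(X,GY)U+2\overline g(X,HY)V+2\{u(Y)GX-u(X)GY\}+\sigma(HX)GY-\sigma(HY)GX+\sigma(X)GHY-\sigma(Y)GHX,$$ one has $S(X,Y)=T(X,Y)=0$ for all $X,Y\in\Gamma(\mathcal H)$ and $S(U,X)=T(V,X)=0$ for all $X$. Submanifold. Let $M$ be an immersed real submanifold of $\overline M$ such that $\mathrm{Rad}\,TM=TM\cap TM^\perp$ is a smooth distribution of constant rank $r>0$ (a null submanifold). Choose a screen distribution $S(TM)$ (a nondegenerate complement of $\mathrm{Rad}\,TM$ in $TM$), a screen transversal bundle $S(TM^\perp)$ (a nondegenerate complement of $\mathrm{Rad}\,TM$ in $TM^\perp$), and a null transversal bundle $l\mathrm{tr}(TM)$, locally spanned by sections $N_1,\dots,N_r$ orthogonal to $S(TM)$ and $S(TM^\perp)$ with $\overline g(N_i,N_j)=0$ and $\overline g(\xi_i,N_j)=\delta_{ij}$ for a local frame $\xi_1,\dots,\xi_r$ of $\mathrm{Rad}\,TM$. Then $T\overline M|_M=TM\oplus l\mathrm{tr}(TM)\oplus S(TM^\perp)$. For $X,Y\in\Gamma(TM)$ let $h^l(X,Y)$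 and $h^s(X,Y)$ be the components of $\overline\nabla_XY$ in $l\mathrm{tr}(TM)$ and $S(TM^\perp)$, where $\overline\nabla$ is the Levi-Civita connection of $\overline g$. Claim. Suppose that $M$ is a quaternion null submanifold: $U$ and $V$ are tangent to $M$ along $M$, and both $\mathrm{Rad}\,TM$ and $S(TM)$ are invariant under $J$, $G$ and $H$. Then $M$ is totally geodesic, that is, $h^l(X,Y)=0$ and $h^s(X,Y)=0$ for all $X,Y\in\Gamma(TM)$. -/

import Mathlib

open Bundle Set
open scoped Manifold ContDiff Topology

noncomputable section

namespace NullContact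

/-! ### Complex manifolds as real manifolds

A complex manifold is a space with holomorphic charts in a complex normed space `E`.  The same charts
make it a real analytic manifold, with real tangent spaces `TangentSpace 𝓘(ℝ, E) x` (a copy of `E`,
through the preferred chart at `x`), on which multiplication by `i` is the complex structure. -/

section ComplexManifold

variable {E : Type*} [NormedAddCommGroup E] [NormedSpace ℂ E]
  {M : Type*} [TopologicalSpace M] [ChartedSpace E M]

/-- A complex manifold is a real analytic manifold with the same charts. -/
instance isManifold_real [IsManifold 𝓘(ℂ, E) ω M] : IsManifold 𝓘(ℝ, E) ω M := by
  refine isManifold_of_contDiffOn _ _ _ fun e e' he he' => ?_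
  have h := HasGroupoid.compatible (G := contDiffGroupoid ω 𝓘(ℂ, E)) he he'
  have h1 := (contDiffGroupoid ω 𝓘(ℂ, E)).mem_iff_of_eqOnSource (Setoid.refl _) |>.1 h
  rw [contDiffGroupoid, mem_groupoid_of_pregroupoid] at h1
  exact h1.1.restrict_scalars ℝ

end ComplexManifold

/-- The almost complex structure `J` of a complex manifold. -/
def J {E : Type*} [NormedAddCommGroup E] [NormedSpace ℂ E]
    {M : Type*} [TopologicalSpace M] [ChartedSpace E M] (x : M) :
    TangentSpace 𝓘(ℝ, E) x →L[ℝ] TangentSpace 𝓘(ℝ, E) x :=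
  show E →L[ℝ] E from Complex.I • ContinuousLinearMap.id ℝ E

/-! ### Vector fields, one-forms and endomorphism fields (`𝕜 = ℝ` or `ℂ`) -/

section Fields

variable {𝕜 : Type*} [RCLike 𝕜] {E : Type*} [NormedAddCommGroup E] [NormedSpace 𝕜 E]
  {M : Type*} [TopologicalSpace M] [ChartedSpace E M]

variable (𝕜 E M) in
/-- (Rough) vector fields. -/
abbrev VField := Π x : M, TangentSpace 𝓘(𝕜, E) x

variable (𝕜 E M) in
/-- (Rough) one-forms. -/
abbrev OneForm := Π x : M, TangentSpace 𝓘(𝕜, E) x →L[𝕜] 𝕜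

variable (𝕜 E M) in
/-- (Rough) `(1,1)`-tensor fields. -/
abbrev EndField := Π x : M, TangentSpace 𝓘(𝕜, E) x →L[𝕜] TangentSpace 𝓘(𝕜, E) x

/-- The vector field `X` is of class `C^k` on `O`. -/
def VField.SmoothOn [IsManifold 𝓘(𝕜, E) 1 M] (k : ℕ∞ω) (X : VField 𝕜 E M) (O : Set M) : Prop :=
  ContMDiffOn 𝓘(𝕜, E) 𝓘(𝕜, E).tangent k (fun x => (⟨x, X x⟩ : TangentBundle 𝓘(𝕜, E) M)) O

/-- The one-form `α` is of class `C^k` on `O`. -/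
def OneForm.SmoothOn [IsManifold 𝓘(𝕜, E) 1 M] (k : ℕ∞ω) (α : OneForm 𝕜 E M) (O : Set M) : Prop :=
  ContMDiffOn 𝓘(𝕜, E) (𝓘(𝕜, E).prod 𝓘(𝕜, E →L[𝕜] 𝕜)) k
    (fun x => TotalSpace.mk' (E →L[𝕜] 𝕜)
      (E := fun x : M => TangentSpace 𝓘(𝕜, E) x →L[𝕜] Bundle.Trivial M 𝕜 x) x (α x)) O

/-- The `(1,1)`-tensor field `A` is of class `C^k` on `O`. -/
def EndField.SmoothOn [IsManifold 𝓘(𝕜, E) 1 M] (k : ℕ∞ω) (A : EndField 𝕜 E M) (O : Set M) : Prop :=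
  ContMDiffOn 𝓘(𝕜, E) (𝓘(𝕜, E).prod 𝓘(𝕜, E →L[𝕜] E)) k
    (fun x => TotalSpace.mk' (E →L[𝕜] E)
      (E := fun x : M => TangentSpace 𝓘(𝕜, E) x →L[𝕜] TangentSpace 𝓘(𝕜, E) x) x (A x)) O

/-- The Lie bracket `[X, Y]`. -/
abbrev bracket (X Y : VField 𝕜 E M) : VField 𝕜 E M := VectorField.mlieBracket 𝓘(𝕜, E) X Y

/-- The exterior derivative of a one-form on vector fields, with the normalisation
`dα(X, Y) = ½ (X α(Y) - Y α(X) - α([X, Y]))`. -/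
def extDer (α : OneForm 𝕜 E M) (X Y : VField 𝕜 E M) (x : M) : 𝕜 :=
  (1 / 2) * (mvfderiv 𝓘(𝕜, E) (fun y => α y (Y y)) x (X x)
    - mvfderiv 𝓘(𝕜, E) (fun y => α y (X y)) x (Y x) - α x (bracket X Y x))

/-- The wedge product of one-forms, with the matching normalisation
`(α ∧ β)(X, Y) = ½ (α(X) β(Y) - α(Y) β(X))`. -/
def wedge (α β : OneForm 𝕜 E M) (X Y : VField 𝕜 E M) (x : M) : 𝕜 :=
  (1 / 2) * (α x (X x) * β x (Y x) - α x (Y x) * β x (X x))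

/-- The Nijenhuis tensor `[A, A](X, Y) = A²[X, Y] + [AX, AY] - A[AX, Y] - A[X, AY]`. -/
def nijenhuis (A : EndField 𝕜 E M) (X Y : VField 𝕜 E M) : VField 𝕜 E M := fun x =>
  A x (A x (bracket X Y x)) + bracket (fun y => A y (X y)) (fun y => A y (Y y)) x
    - A x (bracket (fun y => A y (X y)) Y x) - A x (bracket X (fun y => A y (Y y)) x)

/-- `θ ∧ (dθ)^n` evaluated on `2n + 1` vector fields at `x`, up to a positive constant
depending only on `n`. -/
def contactVolume (n : ℕ) (θ : OneForm 𝕜 E M) (Z : Fin (2 * n + 1) → VField 𝕜 E M) (x : M) : 𝕜 :=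
  ∑ τ : Equiv.Perm (Fin (2 * n + 1)), ((Equiv.Perm.sign τ : ℤ) : 𝕜) *
    (θ x (Z (τ 0) x) * ∏ k : Fin n,
      extDer θ (Z (τ ⟨2 * k + 1, by omega⟩)) (Z (τ ⟨2 * k + 2, by omega⟩)) x)

end Fields

/-! ### Semi-Riemannian metrics and the Levi-Civita connection -/

section Metric

variable (E : Type*) [NormedAddCommGroup E] [NormedSpace ℝ E]
  (M : Type*) [TopologicalSpace M] [ChartedSpace E M]

/-- A smooth semi-Riemannian metric. -/
structure SemiRiemannianMetric [IsManifold 𝓘(ℝ, E) 1 M] where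
  val : Π x : M, TangentSpace 𝓘(ℝ, E) x →L[ℝ] TangentSpace 𝓘(ℝ, E) x →L[ℝ] ℝ
  symm : ∀ x v w, val x v w = val x w v
  nondegenerate : ∀ x v, (∀ w, val x v w = 0) → v = 0
  smooth : ContMDiff 𝓘(ℝ, E) (𝓘(ℝ, E).prod 𝓘(ℝ, E →L[ℝ] E →L[ℝ] ℝ)) ∞
    (fun x => TotalSpace.mk' (E →L[ℝ] E →L[ℝ] ℝ)
      (E := fun x : M => TangentSpace 𝓘(ℝ, E) x →L[ℝ] TangentSpace 𝓘(ℝ, E) x →L[ℝ]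
        Bundle.Trivial M ℝ x) x (val x))

variable {E M} [IsManifold 𝓘(ℝ, E) 1 M]

namespace SemiRiemannianMetric

variable (g : SemiRiemannianMetric E M)

/-- The metric at `x` as a bilinear form. -/
def bilin (x : M) : LinearMap.BilinForm ℝ (TangentSpace 𝓘(ℝ, E) x) := (g.val x).toLinearMap₁₂

theorem bilin_apply (x : M) (v w : TangentSpace 𝓘(ℝ, E) x) : g.bilin x v w = g.val x v w := rfl

theorem bilin_nondegenerate (x : M) : (g.bilin x).Nondegenerate := by
  refine ⟨fun v hv => g.nondegenerate x v hv, fun v hv => g.nondegenerate x v fun w => ?_⟩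
  rw [g.symm]
  exact hv w

theorem bilin_isRefl (x : M) : (g.bilin x).IsRefl := by
  intro v w h
  rw [bilin_apply] at h ⊢
  rw [g.symm, h]

/-- The metric has constant index `ν`: a maximal negative definite subspace of each tangent space
has dimension `ν`. -/
def HasIndex (ν : ℕ) : Prop :=
  ∀ x, sigNeg (LinearMap.BilinMap.toQuadraticMap (g.bilin x)) = ν

/-- The derivative at `x`, in the direction `a`, of the component `g(b, c)` of the metric, where `b`
and `c` are extended with constant components in the chart at `x`. -/
def derivComponent (x : M) (a b c : TangentSpace 𝓘(ℝ, E) x) : ℝ :=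
  mvfderiv 𝓘(ℝ, E)
    (fun y => g.val y (FiberBundle.extend E b y) (FiberBundle.extend E c y)) x a

variable [FiniteDimensional ℝ E]

/-- The Christoffel symbols of the Levi-Civita connection at `x`, in the chart at `x`:
`Γ(v, w)` is the vector with
`g(Γ(v, w), c) = ½ (∂_v g(w, c) + ∂_w g(v, c) - ∂_c g(v, w))` for all `c`;
it is written down with a basis and its `g`-dual basis. -/
def christoffel (x : M) (v w : TangentSpace 𝓘(ℝ, E) x) : TangentSpace 𝓘(ℝ, E) x :=
  letI : FiniteDimensional ℝ (TangentSpace 𝓘(ℝ, E) x) := inferInstanceAs (FiniteDimensional ℝ E)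
  let b := Module.finBasis ℝ (TangentSpace 𝓘(ℝ, E) x)
  ∑ k, ((1 / 2) * (g.derivComponent x v w (b k) + g.derivComponent x w v (b k)
      - g.derivComponent x (b k) v w)) •
    (g.bilin x).dualBasis (g.bilin_nondegenerate x) b k

variable {F : Type*} [NormedAddCommGroup F] [NormedSpace ℝ F]
  {N : Type*} [TopologicalSpace N] [ChartedSpace F N]

/-- The Levi-Civita covariant derivative at `p`, in the direction `v`, of a vector field `Z` along the
map `f : N → M`: in the chart at `f p`, the derivative of the components of `Z` plus the Christoffel
term `Γ(df v, Z)`. -/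
def covAlong (f : N → M) (Z : Π p : N, TangentSpace 𝓘(ℝ, E) (f p)) (p : N)
    (v : TangentSpace 𝓘(ℝ, F) p) : TangentSpace 𝓘(ℝ, E) (f p) :=
  (show TangentSpace 𝓘(ℝ, E) (f p) from
    mvfderiv 𝓘(ℝ, F) (fun q =>
      (trivializationAt E (TangentSpace 𝓘(ℝ, E)) (f p)
        (⟨f q, Z q⟩ : TangentBundle 𝓘(ℝ, E) M)).2) p v)
  + g.christoffel (f p) (mfderiv 𝓘(ℝ, F) 𝓘(ℝ, E) f p v) (Z p)

end SemiRiemannianMetric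

end Metric

/-! ### Null submanifolds -/

section Submanifold

variable {E : Type*} [NormedAddCommGroup E] [NormedSpace ℝ E]
  {M : Type*} [TopologicalSpace M] [ChartedSpace E M] [IsManifold 𝓘(ℝ, E) 1 M]
  (m : ℕ) {N : Type*} [TopologicalSpace N] [ChartedSpace (EuclideanSpace ℝ (Fin m)) N]

/-- A vector field along `f`, smooth on `O`. -/
def SmoothAlongOn (f : N → M) (Z : Π p : N, TangentSpace 𝓘(ℝ, E) (f p)) (O : Set N) : Prop :=
  ContMDiffOn (𝓡 m) 𝓘(ℝ, E).tangent ∞ (fun p => (⟨f p, Z p⟩ : TangentBundle 𝓘(ℝ, E) M)) O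

/-- A family of subspaces `D p` of the tangent spaces at `f p` is a smooth vector bundle over `N` if
locally it has a smooth frame. -/
def IsSmoothSubbundle (f : N → M) (D : Π p : N, Submodule ℝ (TangentSpace 𝓘(ℝ, E) (f p))) : Prop :=
  ∀ p₀ : N, ∃ O : Set N, IsOpen O ∧ p₀ ∈ O ∧
    ∃ (k : ℕ) (s : Fin k → Π p : N, TangentSpace 𝓘(ℝ, E) (f p)),
      (∀ i, SmoothAlongOn m f (s i) O) ∧
      ∀ p ∈ O, LinearIndependent ℝ (fun i => s i p) ∧
        Submodule.span ℝ (Set.range fun i => s i p) = D p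

/-- The tangent space of the submanifold `f : N → M` at `p`. -/
def tangent (f : N → M) (p : N) : Submodule ℝ (TangentSpace 𝓘(ℝ, E) (f p)) :=
  LinearMap.range (mfderiv (𝓡 m) 𝓘(ℝ, E) f p).toLinearMap

/-- The orthogonal complement of the tangent space. -/
def normal (g : SemiRiemannianMetric E M) (f : N → M) (p : N) :
    Submodule ℝ (TangentSpace 𝓘(ℝ, E) (f p)) :=
  (g.bilin (f p)).orthogonal (tangent m f p)

/-- The radical of the tangent space. -/
def rad (g : SemiRiemannianMetric E M) (f : N → M) (p : N) :
    Submodule ℝ (TangentSpace 𝓘(ℝ, E) (f p)) :=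
  tangent m f p ⊓ normal m g f p

/-- `f : N → M` is an `r`-null (immersed) submanifold: the radical is a smooth distribution of
rank `r > 0`. -/
structure IsNullSubmanifold (g : SemiRiemannianMetric E M) (f : N → M) (r : ℕ) : Prop where
  smooth : ContMDiff (𝓡 m) 𝓘(ℝ, E) ∞ f
  immersion : ∀ p, Function.Injective (mfderiv (𝓡 m) 𝓘(ℝ, E) f p)
  rank_pos : 0 < r
  rad_smooth : IsSmoothSubbundle m f (rad m g f)
  rad_rank : ∀ p, Module.finrank ℝ (rad m g f p) = r

/-- A choice of a screen distribution `S(TN)`, a screen transversal bundle `S(TN^⊥)` and a null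
transversal bundle `ltr(TN)` on an `r`-null submanifold. -/
structure ScreenData (g : SemiRiemannianMetric E M) (f : N → M) (r : ℕ) where
  /-- The screen distribution `S(TN)`. -/
  screen : Π p : N, Submodule ℝ (TangentSpace 𝓘(ℝ, E) (f p))
  /-- The screen transversal bundle `S(TN^⊥)`. -/
  screenTr : Π p : N, Submodule ℝ (TangentSpace 𝓘(ℝ, E) (f p))
  /-- The null transversal bundle `ltr(TN)`. -/
  ltr : Π p : N, Submodule ℝ (TangentSpace 𝓘(ℝ, E) (f p))
  screen_smooth : IsSmoothSubbundle m f screen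
  screen_nondegenerate : ∀ p, ((g.bilin (f p)).restrict (screen p)).Nondegenerate
  screen_inf : ∀ p, rad m g f p ⊓ screen p = ⊥
  screen_sup : ∀ p, rad m g f p ⊔ screen p = tangent m f p
  screenTr_smooth : IsSmoothSubbundle m f screenTr
  screenTr_nondegenerate : ∀ p, ((g.bilin (f p)).restrict (screenTr p)).Nondegenerate
  screenTr_inf : ∀ p, rad m g f p ⊓ screenTr p = ⊥
  screenTr_sup : ∀ p, rad m g f p ⊔ screenTr p = normal m g f p
  /-- `ltr(TN)` is locally spanned by a null frame `Nᵢ`, orthogonal to `S(TN)` and `S(TN^⊥)` and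
  dual to a local frame `ξᵢ` of the radical. -/
  ltr_frame : ∀ p₀ : N, ∃ O : Set N, IsOpen O ∧ p₀ ∈ O ∧
    ∃ ξ ν : Fin r → Π p : N, TangentSpace 𝓘(ℝ, E) (f p),
      (∀ i, SmoothAlongOn m f (ξ i) O ∧ SmoothAlongOn m f (ν i) O) ∧
      ∀ p ∈ O, Submodule.span ℝ (Set.range fun i => ξ i p) = rad m g f p ∧
        Submodule.span ℝ (Set.range fun i => ν i p) = ltr p ∧
        (∀ i j, g.val (f p) (ξ i p) (ν j p) = if i = j then 1 else 0) ∧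
        (∀ i j, g.val (f p) (ν i p) (ν j p) = 0) ∧
        (∀ i, ∀ w ∈ screen p, g.val (f p) (ν i p) w = 0) ∧
        (∀ i, ∀ w ∈ screenTr p, g.val (f p) (ν i p) w = 0)

namespace ScreenData

variable {m} {g : SemiRiemannianMetric E M} {f : N → M} {r : ℕ}
  (D : ScreenData m g f r)

theorem eq_zero_of_ltr {p : N} {l : TangentSpace 𝓘(ℝ, E) (f p)} (hl : l ∈ D.ltr p)
    (h : ∀ w ∈ rad m g f p, g.val (f p) w l = 0) : l = 0 := by
  obtain ⟨O, -, hp, ξ, ν, -, hO⟩ := D.ltr_frame p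
  obtain ⟨hξ, hν, hd, -, -, -⟩ := hO p hp
  rw [← hν] at hl
  obtain ⟨c, rfl⟩ := (Submodule.mem_span_range_iff_exists_fun ℝ).1 hl
  have hc : ∀ i, c i = 0 := by
    intro i
    have := h (ξ i p) (hξ ▸ Submodule.subset_span ⟨i, rfl⟩)
    simpa [map_sum, hd] using this
  simp [hc]

theorem finrank_ltr (p : N) : Module.finrank ℝ (D.ltr p) = r := by
  obtain ⟨O, -, hp, ξ, ν, -, hO⟩ := D.ltr_frame p
  obtain ⟨hξ, hν, hd, -, -, -⟩ := hO p hp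
  have hli : LinearIndependent ℝ (fun i => ν i p) := by
    rw [Fintype.linearIndependent_iff]
    intro c hc i
    have := congrArg (g.val (f p) (ξ i p)) hc
    simpa [map_sum, hd] using this
  rw [← hν, finrank_span_eq_card hli, Fintype.card_fin]

theorem finrank_rad (D : ScreenData m g f r) (p : N) : Module.finrank ℝ (rad m g f p) = r := by
  obtain ⟨O, -, hp, ξ, ν, -, hO⟩ := D.ltr_frame p
  obtain ⟨hξ, hν, hd, -, -, -⟩ := hO p hp
  have hli : LinearIndependent ℝ (fun i => ξ i p) := by
    rw [Fintype.linearIndependent_iff]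
    intro c hc i
    have := congrArg (fun z => g.val (f p) z (ν i p)) hc
    simpa [map_sum, sum_apply, hd] using this
  rw [← hξ, finrank_span_eq_card hli, Fintype.card_fin]

theorem eq_zero_of_sum {p : N} {t l s : TangentSpace 𝓘(ℝ, E) (f p)} (ht : t ∈ tangent m f p)
    (hl : l ∈ D.ltr p) (hs : s ∈ D.screenTr p) (h : t + l + s = 0) : t = 0 ∧ l = 0 ∧ s = 0 := by
  have hsn : s ∈ normal m g f p := D.screenTr_sup p ▸ Submodule.mem_sup_right hs
  have hl0 : l = 0 := by
    refine D.eq_zero_of_ltr hl fun w hw => ?_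
    have h1 : g.val (f p) w t = 0 := by
      rw [g.symm]
      exact hw.2 t ht
    have h2 : g.val (f p) w s = 0 := hsn w hw.1
    have h3 := congrArg (g.val (f p) w) h
    simpa [h1, h2] using h3
  subst hl0
  have hts : s = -t := by
    rw [add_zero] at h
    exact (neg_eq_of_add_eq_zero_right h).symm
  have hs0 : s = 0 := by
    have : s ∈ rad m g f p ⊓ D.screenTr p := ⟨⟨hts ▸ neg_mem ht, hsn⟩, hs⟩
    rw [D.screenTr_inf p] at this
    exact (Submodule.mem_bot ℝ).1 this
  subst hs0
  simpa using h

theorem finrank_add [FiniteDimensional ℝ E] (p : N) :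
    Module.finrank ℝ (tangent (E := E) m f p) + Module.finrank ℝ (D.ltr p)
      + Module.finrank ℝ (D.screenTr p) = Module.finrank ℝ (TangentSpace 𝓘(ℝ, E) (f p)) := by
  have : FiniteDimensional ℝ (TangentSpace 𝓘(ℝ, E) (f p)) :=
    inferInstanceAs (FiniteDimensional ℝ E)
  have h1 := LinearMap.BilinForm.finrank_orthogonal (g.bilin_nondegenerate (f p)) (tangent m f p)
  have h2 := Submodule.finrank_sup_add_finrank_inf_eq (rad m g f p) (D.screenTr p)
  have h3 := Submodule.finrank_le (tangent (E := E) m f p)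
  rw [D.screenTr_sup p, D.screenTr_inf p, finrank_bot, D.finrank_rad p] at h2
  rw [D.finrank_ltr p]
  change Module.finrank ℝ (normal m g f p) = _ at h1
  omega

variable [FiniteDimensional ℝ E]

/-- `TM = ltr(TN) ⊕ (TN ⊕ S(TN^⊥))`. -/
theorem isCompl_ltr (p : N) : IsCompl (D.ltr p) (tangent m f p ⊔ D.screenTr p) := by
  have : FiniteDimensional ℝ (TangentSpace 𝓘(ℝ, E) (f p)) :=
    inferInstanceAs (FiniteDimensional ℝ E)
  have hd : Disjoint (D.ltr p) (tangent m f p ⊔ D.screenTr p) := by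
    rw [Submodule.disjoint_def]
    intro x hx hx'
    obtain ⟨t, ht, s, hs, rfl⟩ := Submodule.mem_sup.1 hx'
    exact neg_eq_zero.1 (D.eq_zero_of_sum ht (neg_mem hx) hs (by abel)).2.1
  have hd' : tangent m f p ⊓ D.screenTr p = ⊥ := by
    rw [← disjoint_iff, Submodule.disjoint_def]
    intro x hx hx'
    exact (D.eq_zero_of_sum hx (zero_mem _) (neg_mem hx') (by abel)).1
  have h2 := Submodule.finrank_sup_add_finrank_inf_eq (tangent m f p) (D.screenTr p)
  rw [hd', finrank_bot] at h2
  refine (Submodule.isCompl_iff_disjoint _ _ ?_).2 hd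
  have := D.finrank_add p
  omega

/-- `TM = S(TN^⊥) ⊕ (TN ⊕ ltr(TN))`. -/
theorem isCompl_screenTr (p : N) : IsCompl (D.screenTr p) (tangent m f p ⊔ D.ltr p) := by
  have : FiniteDimensional ℝ (TangentSpace 𝓘(ℝ, E) (f p)) :=
    inferInstanceAs (FiniteDimensional ℝ E)
  have hd : Disjoint (D.screenTr p) (tangent m f p ⊔ D.ltr p) := by
    rw [Submodule.disjoint_def]
    intro x hx hx'
    obtain ⟨t, ht, l, hl, rfl⟩ := Submodule.mem_sup.1 hx'
    exact neg_eq_zero.1 (D.eq_zero_of_sum ht hl (neg_mem hx) (by abel)).2.2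
  have hd' : tangent m f p ⊓ D.ltr p = ⊥ := by
    rw [← disjoint_iff, Submodule.disjoint_def]
    intro x hx hx'
    exact (D.eq_zero_of_sum hx (neg_mem hx') (zero_mem _) (by abel)).1
  have h2 := Submodule.finrank_sup_add_finrank_inf_eq (tangent m f p) (D.ltr p)
  rw [hd', finrank_bot] at h2
  refine (Submodule.isCompl_iff_disjoint _ _ ?_).2 hd
  have := D.finrank_add p
  omega

/-- The ambient Levi-Civita derivative `∇_X Y` at `p` of a vector field `Y` on the submanifold. -/
def ambientCov (g : SemiRiemannianMetric E M) (f : N → M)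
    (X Y : Π p : N, TangentSpace (𝓡 m) p) (p : N) : TangentSpace 𝓘(ℝ, E) (f p) :=
  g.covAlong f (fun q => mfderiv (𝓡 m) 𝓘(ℝ, E) f q (Y q)) p (X p)

/-- The `ltr(TN)`-valued second fundamental form `h^l(X, Y)`: the `ltr(TN)`-component of `∇_X Y` with
respect to `TM = TN ⊕ ltr(TN) ⊕ S(TN^⊥)`. -/
def hl (X Y : Π p : N, TangentSpace (𝓡 m) p) (p : N) : TangentSpace 𝓘(ℝ, E) (f p) :=
  (D.ltr p).projection (tangent m f p ⊔ D.screenTr p) (D.isCompl_ltr p) (ambientCov g f X Y p)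

/-- The `S(TN^⊥)`-valued second fundamental form `h^s(X, Y)`: the `S(TN^⊥)`-component of `∇_X Y` with
respect to `TM = TN ⊕ ltr(TN) ⊕ S(TN^⊥)`. -/
def hs (X Y : Π p : N, TangentSpace (𝓡 m) p) (p : N) : TangentSpace 𝓘(ℝ, E) (f p) :=
  (D.screenTr p).projection (tangent m f p ⊔ D.ltr p) (D.isCompl_screenTr p) (ambientCov g f X Y p)

/-- The submanifold is totally geodesic: `h^l` and `h^s` vanish identically. -/
def TotallyGeodesic [IsManifold (𝓡 m) 1 N] : Prop :=
  ∀ (O : Set N), IsOpen O → ∀ X Y : Π p : N, TangentSpace (𝓡 m) p,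
    VField.SmoothOn ∞ X O → VField.SmoothOn ∞ Y O → ∀ p ∈ O, D.hl X Y p = 0 ∧ D.hs X Y p = 0

end ScreenData

end Submanifold

/-! ### Complex contact metric structures -/

section Contact

variable (E : Type*) [NormedAddCommGroup E] [NormedSpace ℂ E]
  (M : Type*) [TopologicalSpace M] [ChartedSpace E M] [IsManifold 𝓘(ℂ, E) ω M]

/-- A complex contact structure on a complex manifold of complex dimension `2n + 1`: an open cover
`O i` with holomorphic one-forms `θ i` such that `θ i ∧ (dθ i)^n ≠ 0` on `O i`, and
`θ i = φ θ j` on `O i ∩ O j` with `φ` holomorphic and nowhere zero. -/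
structure ComplexContactStructure (n : ℕ) (ι : Type*) where
  dim : Module.finrank ℂ E = 2 * n + 1
  O : ι → Set M
  isOpen : ∀ i, IsOpen (O i)
  cover : ⋃ i, O i = Set.univ
  θ : ι → OneForm ℂ E M
  holomorphic : ∀ i, OneForm.SmoothOn ω (θ i) (O i)
  contact : ∀ i, ∀ x ∈ O i, ∃ (W : Set M) (Z : Fin (2 * n + 1) → VField ℂ E M),
    IsOpen W ∧ x ∈ W ∧ (∀ a, VField.SmoothOn ω (Z a) W) ∧ contactVolume n (θ i) Z x ≠ 0
  overlap : ∀ i j, ∃ φ : M → ℂ, ContMDiffOn 𝓘(ℂ, E) 𝓘(ℂ, ℂ) ω φ (O i ∩ O j) ∧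
    ∀ x ∈ O i ∩ O j, φ x ≠ 0 ∧ θ i x = φ x • θ j x

/-- A complex contact metric structure `(u, v, U, V, G, H, g)`, with `g` a semi-Riemannian metric,
on a complex contact manifold. -/
structure ComplexContactMetricStructure (n : ℕ) (ι : Type*)
    extends ComplexContactStructure E M n ι where
  g : SemiRiemannianMetric E M
  hermitian : ∀ x v w, g.val x (J x v) (J x w) = g.val x v w
  u : ι → OneForm ℝ E M
  v : ι → OneForm ℝ E M
  U : ι → VField ℝ E M
  V : ι → VField ℝ E M
  G : ι → EndField ℝ E M
  H : ι → EndField ℝ E M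
  σ : ι → OneForm ℝ E M
  u_smooth : ∀ i, OneForm.SmoothOn ∞ (u i) (O i)
  v_smooth : ∀ i, OneForm.SmoothOn ∞ (v i) (O i)
  U_smooth : ∀ i, VField.SmoothOn ∞ (U i) (O i)
  V_smooth : ∀ i, VField.SmoothOn ∞ (V i) (O i)
  G_smooth : ∀ i, EndField.SmoothOn ∞ (G i) (O i)
  H_smooth : ∀ i, EndField.SmoothOn ∞ (H i) (O i)
  σ_smooth : ∀ i, OneForm.SmoothOn ∞ (σ i) (O i)
  v_eq : ∀ i, ∀ x ∈ O i, ∀ X, v i x X = u i x (J x X)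
  V_eq : ∀ i, ∀ x ∈ O i, V i x = -J x (U i x)
  H_eq : ∀ i, ∀ x ∈ O i, ∀ X, H i x X = G i x (J x X)
  G_sq : ∀ i, ∀ x ∈ O i, ∀ X, G i x (G i x X) = -X + u i x X • U i x + v i x X • V i x
  H_sq : ∀ i, ∀ x ∈ O i, ∀ X, H i x (H i x X) = -X + u i x X • U i x + v i x X • V i x
  G_skew : ∀ i, ∀ x ∈ O i, ∀ X Y, g.val x (G i x X) Y = -g.val x X (G i x Y)
  U_dual : ∀ i, ∀ x ∈ O i, ∀ X, g.val x (U i x) X = u i x X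
  G_J : ∀ i, ∀ x ∈ O i, ∀ X, G i x (J x X) = -J x (G i x X)
  G_U : ∀ i, ∀ x ∈ O i, G i x (U i x) = 0
  u_U : ∀ i, ∀ x ∈ O i, u i x (U i x) = 1
  /-- The change of the local tensors on overlaps. -/
  change : ∀ i j, ∃ a b : M → ℝ, ContMDiffOn 𝓘(ℝ, E) 𝓘(ℝ, ℝ) ∞ a (O i ∩ O j) ∧
    ContMDiffOn 𝓘(ℝ, E) 𝓘(ℝ, ℝ) ∞ b (O i ∩ O j) ∧ ∀ x ∈ O i ∩ O j,
      a x ^ 2 + b x ^ 2 = 1 ∧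
      u j x = a x • u i x - b x • v i x ∧ v j x = b x • u i x + a x • v i x ∧
      G j x = a x • G i x - b x • H i x ∧ H j x = b x • G i x + a x • H i x
  /-- `θ` is `u - i v` up to a nowhere zero complex-valued factor. -/
  contact_form : ∀ i, ∃ c : M → ℂ, ∀ x ∈ O i, c x ≠ 0 ∧ ∀ X : E,
    (show E →L[ℂ] ℂ from θ i x) X =
      c x * (((show E →L[ℝ] ℝ from u i x) X : ℂ) - Complex.I * (show E →L[ℝ] ℝ from v i x) X)
  /-- `du(X, Y) = g(X, GY) + (σ ∧ v)(X, Y)`. -/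
  du_eq : ∀ i, ∀ W : Set M, IsOpen W → W ⊆ O i → ∀ X Y : VField ℝ E M,
    X.SmoothOn ∞ W → Y.SmoothOn ∞ W → ∀ x ∈ W,
      extDer (u i) X Y x = g.val x (X x) (G i x (Y x)) + wedge (σ i) (v i) X Y x
  /-- `dv(X, Y) = g(X, HY) - (σ ∧ u)(X, Y)`. -/
  dv_eq : ∀ i, ∀ W : Set M, IsOpen W → W ⊆ O i → ∀ X Y : VField ℝ E M,
    X.SmoothOn ∞ W → Y.SmoothOn ∞ W → ∀ x ∈ W,
      extDer (v i) X Y x = g.val x (X x) (H i x (Y x)) - wedge (σ i) (u i) X Y x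

variable {E M}

namespace ComplexContactMetricStructure

variable {n : ℕ} {ι : Type*} (C : ComplexContactMetricStructure E M n ι)

/-- The tensor field `S` on `O i`. -/
def tensorS (i : ι) (X Y : VField ℝ E M) : VField ℝ E M := fun x =>
  nijenhuis (C.G i) X Y x
    + (2 * C.g.val x (X x) (C.G i x (Y x))) • C.U i x
    - (2 * C.g.val x (X x) (C.H i x (Y x))) • C.V i x
    + (2 : ℝ) • (C.v i x (Y x) • C.H i x (X x) - C.v i x (X x) • C.H i x (Y x))
    + C.σ i x (C.G i x (Y x)) • C.H i x (X x)
    - C.σ i x (C.G i x (X x)) • C.H i x (Y x)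
    + C.σ i x (X x) • C.G i x (C.H i x (Y x))
    - C.σ i x (Y x) • C.G i x (C.H i x (X x))

/-- The tensor field `T` on `O i`. -/
def tensorT (i : ι) (X Y : VField ℝ E M) : VField ℝ E M := fun x =>
  nijenhuis (C.H i) X Y x
    - (2 * C.g.val x (X x) (C.G i x (Y x))) • C.U i x
    + (2 * C.g.val x (X x) (C.H i x (Y x))) • C.V i x
    + (2 : ℝ) • (C.u i x (Y x) • C.G i x (X x) - C.u i x (X x) • C.G i x (Y x))
    + C.σ i x (C.H i x (X x)) • C.G i x (Y x)
    - C.σ i x (C.H i x (Y x)) • C.G i x (X x)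
    + C.σ i x (X x) • C.G i x (C.H i x (Y x))
    - C.σ i x (Y x) • C.G i x (C.H i x (X x))

/-- `X` is a section over `W ⊆ O i` of the contact (horizontal) subbundle, the kernel of `θ i`. -/
def IsHorizontalOn (i : ι) (X : VField ℝ E M) (W : Set M) : Prop :=
  ∀ x ∈ W, (show E →L[ℂ] ℂ from C.θ i x) (X x) = 0

/-- Normality: `S(X, Y) = T(X, Y) = 0` for horizontal `X, Y`, and `S(U, X) = T(V, X) = 0` for
all `X`. -/
def IsNormal : Prop :=
  ∀ i, ∀ W : Set M, IsOpen W → W ⊆ C.O i →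
    (∀ X Y : VField ℝ E M, X.SmoothOn ∞ W → Y.SmoothOn ∞ W →
      C.IsHorizontalOn i X W → C.IsHorizontalOn i Y W →
      ∀ x ∈ W, C.tensorS i X Y x = 0 ∧ C.tensorT i X Y x = 0) ∧
    (∀ X : VField ℝ E M, X.SmoothOn ∞ W →
      ∀ x ∈ W, C.tensorS i (C.U i) X x = 0 ∧ C.tensorT i (C.V i) X x = 0)

/-- The family of subspaces `D p` is invariant under `J`, `G` and `H`. -/
def IsInvariant {N : Type*} (f : N → M) (D : Π p : N, Submodule ℝ (TangentSpace 𝓘(ℝ, E) (f p))) :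
    Prop :=
  ∀ p, ∀ w ∈ D p, J (f p) w ∈ D p ∧
    ∀ i, f p ∈ C.O i → C.G i (f p) w ∈ D p ∧ C.H i (f p) w ∈ D p

variable {m : ℕ} {N : Type*} [TopologicalSpace N] [ChartedSpace (EuclideanSpace ℝ (Fin m)) N]
  {f : N → M} {r : ℕ}

/-- A quaternion null submanifold: a null submanifold tangent to the vertical bundle spanned by
`U` and `V`, whose radical and screen distributions are both invariant under `J`, `G` and `H`. -/
structure IsQuaternionNull (D : ScreenData m C.g f r) : Prop where
  null : IsNullSubmanifold m C.g f r
  U_mem : ∀ p i, f p ∈ C.O i → C.U i (f p) ∈ tangent m f p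
  V_mem : ∀ p i, f p ∈ C.O i → C.V i (f p) ∈ tangent m f p
  rad_invariant : C.IsInvariant f (rad m C.g f)
  screen_invariant : C.IsInvariant f D.screen

end ComplexContactMetricStructure

end Contact

end NullContact

/-!
The reason is local and comes down to two formulas for the Levi-Civita connection of a normal complex
contact metric structure, valid for horizontal vectors `X`, `Y`, `Z` (those in the kernel of `u` and
`v`):

* `g(∇_X U, Y) = g(X, GY)` and `g(∇_X V, Y) = g(X, HY)` (`NormalJet.covVecForm_horizontal`),
* `g((∇_X G) Y, Z) = σ(X) g(HY, Z)` and `g((∇_X H) Y, Z) = -σ(X) g(GY, Z)`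
  (`NormalJet.covEndForm_horizontal`).

The second one is the analogue of the fact that an almost Hermitian manifold with closed fundamental
form and vanishing Nijenhuis tensor is Kähler: up to `σ`-terms, the structure equation for `du` says
that `g(·, G ·)` is closed and `S = 0` says that the Nijenhuis tensor of `G` vanishes on horizontal
vectors.  The formulas for `V` and `H` are those for `U` and `G` applied to the structure turned by a
right angle, `(u, v, U, V, G, H)` replaced by `(-v, u, -V, U, -H, G)`, whose tensor `S` is `T`
(`NormalJet.rotate`).

Let `w` be normal to a submanifold with `U`, `V` tangent to it and tangent spaces invariant under `G`
and `H`; a quaternion null submanifold is one, as its tangent spaces are the sums of the radical and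
the screen.  Put `k(X, Y, w) = g(∇_X Y, w)`, which is tensorial and symmetric in the tangent vectors
`X`, `Y`.  The formulas give, for horizontal `X` and `Y`,
`k(X, U, w) = k(X, V, w) = 0`, `k(X, GY, w) = -k(X, Y, Gw)` and `k(X, HY, w) = -k(X, Y, Hw)`.
Moving `G` and `H` off both arguments of `k(GX, HY, w)`, in the two possible orders, gives
`k(X, Y, HGw) = k(X, Y, GHw)`; as `GH = -HG`, and `GH` is invertible on normal vectors, `k` vanishes on
horizontal vectors.  The vertical directions are dealt with by the structure equations
(`NormalJet.form_eq_zero`).  So `∇_X Y` is orthogonal to the normal space, which by nondegeneracy of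
the ambient metric means that it is tangent, and both transversal components vanish.

The computations are done in the preferred chart of the ambient manifold at a point, where the
structure is recorded as a `NormalJet`.
-/

namespace NullContact

/-! ### Pointwise algebra of a complex contact metric structure -/

section Algebra

variable {E : Type*} [NormedAddCommGroup E] [NormedSpace ℝ E]

/-- The pointwise identities between the metric, the one-forms `u`, `v`, their dual vectors `U`, `V`
and the endomorphisms `G`, `H = GJ` on one tangent space of a complex contact metric manifold.  The
complex structure `J` is eliminated in favour of `G` and `H`. -/
structure ContactAlgebra (g : E →L[ℝ] E →L[ℝ] ℝ) (u v : E →L[ℝ] ℝ) (U V : E)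
    (G H : E →L[ℝ] E) : Prop where
  symm : ∀ a b, g a b = g b a
  gU : ∀ a, g U a = u a
  gV : ∀ a, g V a = v a
  uU : u U = 1
  vV : v V = 1
  uV : u V = 0
  vU : v U = 0
  GU : G U = 0
  GV : G V = 0
  HU : H U = 0
  HV : H V = 0
  G_sq : ∀ a, G (G a) = -a + u a • U + v a • V
  H_sq : ∀ a, H (H a) = -a + u a • U + v a • V
  GH : ∀ a, G (H a) = -H (G a)
  G_skew : ∀ a b, g (G a) b = -g a (G b)
  H_skew : ∀ a b, g (H a) b = -g a (H b)

namespace ContactAlgebra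

variable {g : E →L[ℝ] E →L[ℝ] ℝ} {u v : E →L[ℝ] ℝ} {U V : E} {G H : E →L[ℝ] E}

/-- The rotation of the structure by a right angle: the admissible change of local tensors with
`a = 0` and `b = 1`.  It exchanges the roles of `G` and `H`. -/
theorem rotate (h : ContactAlgebra g u v U V G H) :
    ContactAlgebra g (-v) u (-V) U (-H) G where
  symm := h.symm
  gU a := by simp [h.gV]
  gV := h.gU
  uU := by simp [h.vV]
  vV := h.uU
  uV := by simp [h.vU]
  vU := by simp [h.uV]
  GU := by simp [h.HV]
  GV := by simp [h.HU]
  HU := by simp [h.GV]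
  HV := h.GU
  G_sq a := by simp [h.H_sq]; abel
  H_sq a := by simp [h.G_sq]; abel
  GH a := by simp [h.GH]
  G_skew a b := by simp [h.H_skew]
  H_skew := h.G_skew

theorem u_G (h : ContactAlgebra g u v U V G H) (a : E) : u (G a) = 0 := by
  rw [← h.gU, h.symm, h.G_skew, h.GU, map_zero, neg_zero]

theorem v_G (h : ContactAlgebra g u v U V G H) (a : E) : v (G a) = 0 := by
  rw [← h.gV, h.symm, h.G_skew, h.GV, map_zero, neg_zero]

theorem u_H (h : ContactAlgebra g u v U V G H) (a : E) : u (H a) = 0 := by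
  rw [← h.gU, h.symm, h.H_skew, h.HU, map_zero, neg_zero]

theorem v_H (h : ContactAlgebra g u v U V G H) (a : E) : v (H a) = 0 := by
  rw [← h.gV, h.symm, h.H_skew, h.HV, map_zero, neg_zero]

theorem G_sq_of_horizontal (h : ContactAlgebra g u v U V G H) {a : E} (hu : u a = 0)
    (hv : v a = 0) : G (G a) = -a := by
  simp [h.G_sq, hu, hv]

/-- The algebraic core of the formula for `∇G`: a trilinear form with the symmetries of
`g((∇_a G) b, c)` vanishes on horizontal vectors when the two-form of `G` is closed and the
Nijenhuis tensor of `G` vanishes.  As in the almost Hermitian case, twice the form is a combination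
of the exterior derivative and the Nijenhuis tensor. -/
theorem eq_zero_of_closed_of_integrable (h : ContactAlgebra g u v U V G H) {A : E → E → E → ℝ}
    (hskew : ∀ a b c, A a b c = -A a c b) (hneg : ∀ a b c, A a b (-c) = -A a b c)
    (hG : ∀ a b c, u b = 0 → v b = 0 → u c = 0 → v c = 0 → A a (G b) c = A a b (G c))
    (hcyc : ∀ a b c, u a = 0 → v a = 0 → u b = 0 → v b = 0 → u c = 0 → v c = 0 →
      A a b c + A b c a + A c a b = 0)
    (hN : ∀ a b c, u a = 0 → v a = 0 → u b = 0 → v b = 0 → u c = 0 → v c = 0 →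
      A (G a) b c - A (G b) a c - A b a (G c) + A a b (G c) = 0)
    {a b c : E} (ua : u a = 0) (va : v a = 0) (ub : u b = 0) (vb : v b = 0) (uc : u c = 0)
    (vc : v c = 0) : A a b c = 0 := by
  have h1 := hcyc a b c ua va ub vb uc vc
  have h2 := hcyc a (G b) (G c) ua va (h.u_G b) (h.v_G b) (h.u_G c) (h.v_G c)
  have h3 := hN b c (G a) ub vb uc vc (h.u_G a) (h.v_G a)
  have e1 : A a (G b) (G c) = -A a b c := by
    rw [hG a b (G c) ub vb (h.u_G c) (h.v_G c), h.G_sq_of_horizontal uc vc, hneg]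
  have e2 : A (G b) (G c) a = A (G b) c (G a) := hG _ _ _ uc vc ua va
  have e3 : A (G c) a (G b) = A (G c) (G a) b := (hG _ _ _ ua va ub vb).symm
  rw [h.G_sq_of_horizontal ua va, hneg, hneg] at h3
  have e4 := hskew (G c) (G a) b
  have e5 := hskew c a b
  linarith

end ContactAlgebra
end Algebra

/-! ### The structure in a chart: formulas for the covariant derivatives of `G` and `U` -/

section Flat

variable {E : Type*} [NormedAddCommGroup E] [NormedSpace ℝ E]

/-- The Christoffel symbols of the first kind of the metric `g` on an open set of a vector space:
`K(a, b, c) = g(Γ(a, b), c)`. -/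
def christoffelForm (g : E → E →L[ℝ] E →L[ℝ] ℝ) (z a b c : E) : ℝ :=
  (1 / 2) * (fderiv ℝ g z a b c + fderiv ℝ g z b a c - fderiv ℝ g z c a b)

/-- `g((∇_a G) b, c)` at `z`, for the Levi-Civita connection of `g` and an endomorphism field `G`
that is skew-symmetric for `g`. -/
def covEndForm (g : E → E →L[ℝ] E →L[ℝ] ℝ) (G : E → E →L[ℝ] E) (z a b c : E) : ℝ :=
  g z (fderiv ℝ G z a b) c + christoffelForm g z a (G z b) c + christoffelForm g z a b (G z c)

/-- `g(∇_a U, b)` at `z`, for the Levi-Civita connection of `g`. -/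
def covVecForm (g : E → E →L[ℝ] E →L[ℝ] ℝ) (U : E → E) (z a b : E) : ℝ :=
  g z (fderiv ℝ U z a) b + christoffelForm g z a (U z) b

/-- The part of the normal complex contact metric structure, expressed in a chart near the point `z`,
that determines `∇G` and `∇U`: the pointwise identities and the structure equations near `z`, and the
vanishing of the tensor `S` at `z`.  The Nijenhuis tensor in `S` is written with the derivative of
`G`, as it does not depend on the extension of vectors to vector fields. -/
structure NormalJet (g : E → E →L[ℝ] E →L[ℝ] ℝ) (u v σ : E → E →L[ℝ] ℝ) (U V : E → E)
    (G H : E → E →L[ℝ] E) (z : E) : Prop where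
  diff_g : DifferentiableAt ℝ g z
  contDiff_u : ContDiffAt ℝ 2 u z
  contDiff_v : ContDiffAt ℝ 2 v z
  diff_σ : DifferentiableAt ℝ σ z
  diff_U : DifferentiableAt ℝ U z
  diff_V : DifferentiableAt ℝ V z
  diff_G : DifferentiableAt ℝ G z
  diff_H : DifferentiableAt ℝ H z
  algebra : ∀ᶠ y in 𝓝 z, ContactAlgebra (g y) (u y) (v y) (U y) (V y) (G y) (H y)
  du : ∀ᶠ y in 𝓝 z, ∀ a b, fderiv ℝ u y a b - fderiv ℝ u y b a
    = 2 * g y a (G y b) + σ y a * v y b - σ y b * v y a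
  dv : ∀ᶠ y in 𝓝 z, ∀ a b, fderiv ℝ v y a b - fderiv ℝ v y b a
    = 2 * g y a (H y b) - (σ y a * u y b - σ y b * u y a)
  tensorS : ∀ a b, u z a = 0 → v z a = 0 → u z b = 0 → v z b = 0 →
    fderiv ℝ G z (G z a) b - fderiv ℝ G z (G z b) a + G z (fderiv ℝ G z b a)
      - G z (fderiv ℝ G z a b)
      + (2 * g z a (G z b)) • U z - (2 * g z a (H z b)) • V z
      + σ z (G z b) • H z a - σ z (G z a) • H z b
      + σ z a • G z (H z b) - σ z b • G z (H z a) = 0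
  tensorS_U : ∀ b, G z (fderiv ℝ G z b (U z)) - fderiv ℝ G z (G z b) (U z)
      - G z (fderiv ℝ G z (U z) b) + σ z (U z) • G z (H z b) = 0

/-! Product rules in the form in which they are used below. -/

section Product

variable {F F' : Type*} [NormedAddCommGroup F] [NormedSpace ℝ F] [NormedAddCommGroup F']
  [NormedSpace ℝ F'] {z : E}

theorem fderiv_clm_apply_apply {A : E → F →L[ℝ] F'} {X : E → F} (hA : DifferentiableAt ℝ A z)
    (hX : DifferentiableAt ℝ X z) (a : E) :
    fderiv ℝ (fun y => A y (X y)) z a = fderiv ℝ A z a (X z) + A z (fderiv ℝ X z a) := by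
  rw [fderiv_clm_apply hA hX]
  simp [add_comm]

theorem fderiv_clm_apply_const {A : E → F →L[ℝ] F'} (hA : DifferentiableAt ℝ A z) (b : F) (a : E) :
    fderiv ℝ (fun y => A y b) z a = fderiv ℝ A z a b := by
  rw [fderiv_clm_apply_apply hA (differentiableAt_const b)]
  simp

theorem fderiv_bilin_apply {g : E → F →L[ℝ] F →L[ℝ] F'} {X Y : E → F} (hg : DifferentiableAt ℝ g z)
    (hX : DifferentiableAt ℝ X z) (hY : DifferentiableAt ℝ Y z) (a : E) :
    fderiv ℝ (fun y => g y (X y) (Y y)) z a = fderiv ℝ g z a (X z) (Y z)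
      + g z (fderiv ℝ X z a) (Y z) + g z (X z) (fderiv ℝ Y z a) := by
  rw [fderiv_clm_apply_apply (hg.clm_apply hX) hY, fderiv_clm_apply_apply hg hX]
  simp

end Product

namespace NormalJet

variable {g : E → E →L[ℝ] E →L[ℝ] ℝ} {u v σ : E → E →L[ℝ] ℝ} {U V : E → E}
  {G H : E → E →L[ℝ] E} {z : E}

theorem algebra_self (h : NormalJet g u v σ U V G H z) :
    ContactAlgebra (g z) (u z) (v z) (U z) (V z) (G z) (H z) := h.algebra.self_of_nhds

theorem diff_u (h : NormalJet g u v σ U V G H z) : DifferentiableAt ℝ u z :=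
  h.contDiff_u.differentiableAt (by norm_num)

theorem diff_v (h : NormalJet g u v σ U V G H z) : DifferentiableAt ℝ v z :=
  h.contDiff_v.differentiableAt (by norm_num)

theorem fderiv_g_symm (h : NormalJet g u v σ U V G H z) (a b c : E) :
    fderiv ℝ g z a b c = fderiv ℝ g z a c b := by
  have key : (fun y => g y b c) =ᶠ[𝓝 z] fun y => g y c b :=
    h.algebra.mono fun y hy => hy.symm b c
  have := DFunLike.congr_fun (key.fderiv_eq (𝕜 := ℝ)) a
  simpa [fderiv_bilin_apply h.diff_g] using this

theorem christoffelForm_symm (h : NormalJet g u v σ U V G H z) (a b c : E) :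
    christoffelForm g z a b c = christoffelForm g z b a c := by
  rw [christoffelForm, christoffelForm, h.fderiv_g_symm c a b]
  ring

theorem christoffelForm_metric (h : NormalJet g u v σ U V G H z) (a b c : E) :
    christoffelForm g z a b c + christoffelForm g z a c b = fderiv ℝ g z a b c := by
  rw [christoffelForm, christoffelForm, h.fderiv_g_symm c a b, h.fderiv_g_symm b a c,
    h.fderiv_g_symm a c b]
  ring

set_option synthInstance.maxHeartbeats 100000 in
@[simp] theorem christoffelForm_neg_mid (g : E → E →L[ℝ] E →L[ℝ] ℝ) (z a b c : E) :
    christoffelForm g z a (-b) c = -christoffelForm g z a b c := by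
  simp only [christoffelForm, map_neg, neg_apply]; ring

set_option synthInstance.maxHeartbeats 100000 in
@[simp] theorem christoffelForm_neg_right (g : E → E →L[ℝ] E →L[ℝ] ℝ) (z a b c : E) :
    christoffelForm g z a b (-c) = -christoffelForm g z a b c := by
  simp only [christoffelForm, map_neg, neg_apply]; ring

set_option synthInstance.maxHeartbeats 100000 in
@[simp] theorem christoffelForm_zero_mid (g : E → E →L[ℝ] E →L[ℝ] ℝ) (z a c : E) :
    christoffelForm g z a 0 c = 0 := by
  simp only [christoffelForm, map_zero, zero_apply]; ring

theorem covEndForm_skew (h : NormalJet g u v σ U V G H z) (a b c : E) :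
    covEndForm g G z a b c = -covEndForm g G z a c b := by
  have key : (fun y => g y (G y b) c) =ᶠ[𝓝 z] fun y => -g y b (G y c) :=
    h.algebra.mono fun y hy => hy.G_skew b c
  have hb := h.diff_G.clm_apply (differentiableAt_const b)
  have hc := h.diff_G.clm_apply (differentiableAt_const c)
  have := DFunLike.congr_fun (key.fderiv_eq (𝕜 := ℝ)) a
  simp only [fderiv_bilin_apply h.diff_g hb (differentiableAt_const c), fderiv_fun_neg,
    neg_apply, fderiv_bilin_apply h.diff_g (differentiableAt_const b) hc,
    fderiv_clm_apply_const h.diff_G] at this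
  simp only [fderiv_fun_const, Pi.zero_apply, zero_apply, map_zero,
    add_zero] at this
  have e1 := h.christoffelForm_metric a (G z b) c
  have e2 := h.christoffelForm_metric a b (G z c)
  have e3 := h.algebra_self.symm b (fderiv ℝ G z a c)
  simp only [covEndForm]
  linarith

theorem covEndForm_neg (g : E → E →L[ℝ] E →L[ℝ] ℝ) (G : E → E →L[ℝ] E) (z a b c : E) :
    covEndForm g G z a b (-c) = -covEndForm g G z a b c := by
  simp [covEndForm]; ring

theorem covEndForm_comm (h : NormalJet g u v σ U V G H z) (a : E) {b c : E} (ub : u z b = 0)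
    (vb : v z b = 0) (uc : u z c = 0) (vc : v z c = 0) :
    covEndForm g G z a (G z b) c = covEndForm g G z a b (G z c) := by
  have alg := h.algebra_self
  have key : (fun y => G y (G y b)) =ᶠ[𝓝 z] fun y => -b + u y b • U y + v y b • V y :=
    h.algebra.mono fun y hy => hy.G_sq b
  have hb := h.diff_G.clm_apply (differentiableAt_const b)
  have hub := h.diff_u.clm_apply (differentiableAt_const b)
  have hvb := h.diff_v.clm_apply (differentiableAt_const b)
  have := congrArg (fun w => g z w c) (DFunLike.congr_fun (key.fderiv_eq (𝕜 := ℝ)) a)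
  rw [fderiv_fun_add ((differentiableAt_const _).fun_add (hub.fun_smul h.diff_U))
      (hvb.fun_smul h.diff_V),
    fderiv_fun_add (differentiableAt_const _) (hub.fun_smul h.diff_U), fderiv_fun_smul hub h.diff_U,
    fderiv_fun_smul hvb h.diff_V] at this
  simp only [fderiv_clm_apply_apply h.diff_G hb, fderiv_clm_apply_const h.diff_G] at this
  simp [ub, vb, alg.gU, alg.gV, uc, vc] at this
  have e1 := alg.G_skew (fderiv ℝ G z a b) c
  simp only [covEndForm, alg.G_sq_of_horizontal ub vb, alg.G_sq_of_horizontal uc vc,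
    christoffelForm_neg_mid, christoffelForm_neg_right]
  linarith

/-- The two-form `g(·, G ·) = du - σ ∧ v` has exterior derivative `σ ∧ dv` on the kernel of `v`. -/
theorem covEndForm_cyclic (h : NormalJet g u v σ U V G H z) {a b c : E} (va : v z a = 0)
    (vb : v z b = 0) (vc : v z c = 0) :
    covEndForm g G z a b c + covEndForm g G z b c a + covEndForm g G z c a b
      = σ z a * g z (H z b) c + σ z b * g z (H z c) a + σ z c * g z (H z a) b := by
  have alg := h.algebra_self
  have hd2 : DifferentiableAt ℝ (fderiv ℝ u) z :=
    (h.contDiff_u.fderiv_right (m := 1) (by norm_num)).differentiableAt (by norm_num)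
  have hsymm : ∀ x y, fderiv ℝ (fderiv ℝ u) z x y = fderiv ℝ (fderiv ℝ u) z y x :=
    h.contDiff_u.isSymmSndFDerivAt (by simp)
  have D : ∀ x y w, v z y = 0 → v z w = 0 →
      fderiv ℝ (fderiv ℝ u) z x y w - fderiv ℝ (fderiv ℝ u) z x w y
      = 2 * (fderiv ℝ g z x y (G z w) + g z y (fderiv ℝ G z x w))
        + σ z y * fderiv ℝ v z x w - σ z w * fderiv ℝ v z x y := by
    intro x y w vy vw
    have key : (fun p => fderiv ℝ u p y w - fderiv ℝ u p w y) =ᶠ[𝓝 z]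
        fun p => 2 * g p y (G p w) + σ p y * v p w - σ p w * v p y :=
      h.du.mono fun p hp => hp y w
    have c1 {q : E} := differentiableAt_const (𝕜 := ℝ) (x := z) q
    have hw := h.diff_G.clm_apply (c1 (q := w))
    have := DFunLike.congr_fun (key.fderiv_eq (𝕜 := ℝ)) x
    rw [fderiv_fun_sub ((hd2.clm_apply c1).clm_apply c1) ((hd2.clm_apply c1).clm_apply c1),
      fderiv_fun_sub ((((h.diff_g.clm_apply c1).clm_apply hw).const_mul 2).fun_add
        ((h.diff_σ.clm_apply c1).fun_mul (h.diff_v.clm_apply c1)))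
        ((h.diff_σ.clm_apply c1).fun_mul (h.diff_v.clm_apply c1)),
      fderiv_fun_add (((h.diff_g.clm_apply c1).clm_apply hw).const_mul 2)
        ((h.diff_σ.clm_apply c1).fun_mul (h.diff_v.clm_apply c1)),
      fderiv_const_mul ((h.diff_g.clm_apply c1).clm_apply hw),
      fderiv_fun_mul (h.diff_σ.clm_apply c1) (h.diff_v.clm_apply c1),
      fderiv_fun_mul (h.diff_σ.clm_apply c1) (h.diff_v.clm_apply c1)] at this
    simp only [sub_apply, add_apply, smul_apply, smul_eq_mul,
      fderiv_clm_apply_const (hd2.clm_apply c1), fderiv_clm_apply_const hd2,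
      fderiv_bilin_apply h.diff_g c1 hw, fderiv_clm_apply_const h.diff_G,
      fderiv_clm_apply_const h.diff_σ, fderiv_clm_apply_const h.diff_v] at this
    simp [vy, vw] at this
    linarith
  have d1 := D a b c vb vc
  have d2 := D b c a vc va
  have d3 := D c a b va vb
  have s1 := DFunLike.congr_fun (hsymm a b) c
  have s2 := DFunLike.congr_fun (hsymm b c) a
  have s3 := DFunLike.congr_fun (hsymm c a) b
  have dv := h.dv.self_of_nhds
  have v1 := dv a b
  have v2 := dv b c
  have v3 := dv c a
  have k1 := h.christoffelForm_metric a b (G z c)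
  have k2 := h.christoffelForm_metric b c (G z a)
  have k3 := h.christoffelForm_metric c a (G z b)
  have t1 := h.christoffelForm_symm a b (G z c)
  have t2 := h.christoffelForm_symm b c (G z a)
  have t3 := h.christoffelForm_symm c a (G z b)
  have m1 := alg.symm b (fderiv ℝ G z a c)
  have m2 := alg.symm c (fderiv ℝ G z b a)
  have m3 := alg.symm a (fderiv ℝ G z c b)
  have k4 := h.covEndForm_skew a b c
  have k5 := h.covEndForm_skew b c a
  have k6 := h.covEndForm_skew c a b
  have w1 := alg.H_skew a b
  have w2 := alg.H_skew b c
  have w3 := alg.H_skew c a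
  rw [k4, k5, k6]
  simp only [covEndForm]
  -- the second derivatives of `u` and the Christoffel symbols cancel in the cyclic sum
  linear_combination (1 / 2) * d1 + (1 / 2) * d2 + (1 / 2) * d3
    - (1 / 2) * s1 - (1 / 2) * s2 - (1 / 2) * s3 + m1 + m2 + m3 - k1 - k2 - k3 + t1 + t2 + t3
    - (1 / 2) * σ z c * v1 - (1 / 2) * σ z a * v2 - (1 / 2) * σ z b * v3
    - σ z c * w1 - σ z a * w2 - σ z b * w3

end NormalJet
end Flat

section FlatFormulas

variable {E : Type*} [NormedAddCommGroup E] [NormedSpace ℝ E]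

namespace NormalJet

variable {g : E → E →L[ℝ] E →L[ℝ] ℝ} {u v σ : E → E →L[ℝ] ℝ} {U V : E → E}
  {G H : E → E →L[ℝ] E} {z : E}

/-- The equation `S = 0` on horizontal vectors, paired with a horizontal vector, in terms of `∇G`. -/
theorem covEndForm_nijenhuis (h : NormalJet g u v σ U V G H z) {a b c : E}
    (ua : u z a = 0) (va : v z a = 0) (ub : u z b = 0) (vb : v z b = 0) (uc : u z c = 0)
    (vc : v z c = 0) :
    covEndForm g G z (G z a) b c - covEndForm g G z (G z b) a c - covEndForm g G z b a (G z c)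
      + covEndForm g G z a b (G z c)
      + σ z (G z b) * g z (H z a) c - σ z (G z a) * g z (H z b) c
      + σ z a * g z (G z (H z b)) c - σ z b * g z (G z (H z a)) c = 0 := by
  have alg := h.algebra_self
  have s := congrArg (fun w => g z w c) (h.tensorS a b ua va ub vb)
  simp only [map_add, map_sub, map_smul, add_apply, sub_apply, smul_apply, smul_eq_mul, map_zero,
    zero_apply, alg.gU, alg.gV, uc, vc, mul_zero, add_zero, sub_zero, alg.G_skew] at s
  simp only [covEndForm, alg.G_sq_of_horizontal uc vc, christoffelForm_neg_right, alg.G_skew]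
  have t1 := h.christoffelForm_symm (G z a) (G z b) c
  have t2 := h.christoffelForm_symm (G z a) b (G z c)
  have t3 := h.christoffelForm_symm (G z b) a (G z c)
  have t4 := h.christoffelForm_symm a b c
  linarith

/-- On horizontal vectors `g((∇_a G) b, c) = σ(a) g(H b, c)`. -/
theorem covEndForm_horizontal (h : NormalJet g u v σ U V G H z) {a b c : E}
    (ua : u z a = 0) (va : v z a = 0) (ub : u z b = 0) (vb : v z b = 0) (uc : u z c = 0)
    (vc : v z c = 0) : covEndForm g G z a b c = σ z a * g z (H z b) c := by
  have alg := h.algebra_self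
  have HG : ∀ a b, g z (H z (G z a)) b = g z (H z a) (G z b) := fun a b => by
    have e := alg.G_skew (H z a) b
    rwa [alg.GH, map_neg, neg_apply, neg_inj] at e
  refine sub_eq_zero.1 (alg.eq_zero_of_closed_of_integrable
    (A := fun a b c => covEndForm g G z a b c - σ z a * g z (H z b) c) ?_ ?_ ?_ ?_ ?_
    ua va ub vb uc vc)
  · intro a b c
    have e1 := h.covEndForm_skew a b c
    have e2 := alg.H_skew b c
    have e3 := alg.symm b (H z c)
    rw [e1, e2, e3]; ring
  · intro a b c
    simp only [covEndForm_neg, map_neg]; ring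
  · intro a b c ub vb uc vc
    rw [h.covEndForm_comm a ub vb uc vc, HG]
  · intro a b c ua va ub vb uc vc
    have := h.covEndForm_cyclic va vb vc
    linarith
  · intro a b c ua va ub vb uc vc
    have := h.covEndForm_nijenhuis ua va ub vb uc vc
    have e1 := alg.G_skew (H z a) c
    have e2 := alg.G_skew (H z b) c
    rw [e1, e2] at this
    linarith

theorem covVecForm_sub (h : NormalJet g u v σ U V G H z) (a b : E) :
    covVecForm g U z a b - covVecForm g U z b a
      = 2 * g z a (G z b) + σ z a * v z b - σ z b * v z a := by
  have D : ∀ a b, fderiv ℝ u z a b = fderiv ℝ g z a (U z) b + g z (fderiv ℝ U z a) b := by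
    intro a b
    have key : (fun y => g y (U y) b) =ᶠ[𝓝 z] fun y => u y b := h.algebra.mono fun y hy => hy.gU b
    have := DFunLike.congr_fun (key.fderiv_eq (𝕜 := ℝ)) a
    rw [fderiv_bilin_apply h.diff_g h.diff_U (differentiableAt_const b),
      fderiv_clm_apply_const h.diff_u] at this
    simpa using this.symm
  have e := h.du.self_of_nhds a b
  rw [D a b, D b a] at e
  have k1 := h.christoffelForm_metric a (U z) b
  have k2 := h.christoffelForm_metric b (U z) a
  have k3 := h.christoffelForm_symm a b (U z)
  simp only [covVecForm]
  linarith

theorem covVecForm_U_self (h : NormalJet g u v σ U V G H z) (a : E) :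
    covVecForm g U z a (U z) = 0 := by
  have key : (fun y => g y (U y) (U y)) =ᶠ[𝓝 z] fun _ => (1 : ℝ) :=
    h.algebra.mono fun y hy => (hy.gU _).trans hy.uU
  have := DFunLike.congr_fun (key.fderiv_eq (𝕜 := ℝ)) a
  rw [fderiv_bilin_apply h.diff_g h.diff_U h.diff_U] at this
  simp only [fderiv_fun_const, Pi.zero_apply, zero_apply] at this
  have k := h.christoffelForm_metric a (U z) (U z)
  have s := h.algebra_self.symm (U z) (fderiv ℝ U z a)
  simp only [covVecForm]
  linarith

theorem covVecForm_U_V (h : NormalJet g u v σ U V G H z) (a : E) :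
    covVecForm g U z a (V z) + covVecForm g V z a (U z) = 0 := by
  have key : (fun y => g y (U y) (V y)) =ᶠ[𝓝 z] fun _ => (0 : ℝ) :=
    h.algebra.mono fun y hy => (hy.gU _).trans hy.uV
  have := DFunLike.congr_fun (key.fderiv_eq (𝕜 := ℝ)) a
  rw [fderiv_bilin_apply h.diff_g h.diff_U h.diff_V] at this
  simp only [fderiv_fun_const, Pi.zero_apply, zero_apply] at this
  have k := h.christoffelForm_metric a (U z) (V z)
  have s := h.algebra_self.symm (U z) (fderiv ℝ V z a)
  simp only [covVecForm]
  linarith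

theorem covVecForm_neg (g : E → E →L[ℝ] E →L[ℝ] ℝ) (U : E → E) (z a b : E) :
    covVecForm g U z a (-b) = -covVecForm g U z a b := by
  simp only [covVecForm, map_neg, christoffelForm_neg_right]; ring

/-- `(∇_a G) U = -G ∇_a U`. -/
theorem covEndForm_U (h : NormalJet g u v σ U V G H z) (a c : E) :
    covEndForm g G z a (U z) c = covVecForm g U z a (G z c) := by
  have alg := h.algebra_self
  have key : (fun y => G y (U y)) =ᶠ[𝓝 z] fun _ => (0 : E) := h.algebra.mono fun y hy => hy.GU
  have := congrArg (fun w => g z w c) (DFunLike.congr_fun (key.fderiv_eq (𝕜 := ℝ)) a)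
  rw [fderiv_clm_apply_apply h.diff_G h.diff_U] at this
  simp only [fderiv_fun_const, Pi.zero_apply, zero_apply, map_zero, map_add, add_apply,
    alg.G_skew] at this
  simp only [covEndForm, covVecForm, alg.GU, christoffelForm_zero_mid]
  linarith

/-- On horizontal vectors `∇U` is skew-symmetric: there `U` is a Killing field. -/
theorem covVecForm_G_G (h : NormalJet g u v σ U V G H z) {b c : E} (vb : v z b = 0)
    (uc : u z c = 0) (vc : v z c = 0) :
    covVecForm g U z (G z b) (G z c) + covVecForm g U z (G z c) (G z b) = 0 := by
  have alg := h.algebra_self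
  have s := congrArg (fun w => g z w c) (h.tensorS_U b)
  simp only [map_add, map_sub, map_smul, add_apply, sub_apply, smul_apply, smul_eq_mul, map_zero,
    zero_apply, alg.G_skew] at s
  have cyc := h.covEndForm_cyclic (a := U z) (b := b) (c := G z c) alg.vU vb (alg.v_G c)
  have e1 := h.covEndForm_U (G z b) c
  have e2 := h.covEndForm_U b (G z c)
  have e3 := h.covEndForm_U (G z c) b
  have e4 := h.covEndForm_skew b (G z c) (U z)
  have n := covVecForm_neg g U z b c
  rw [alg.G_sq_of_horizontal uc vc, n] at e2
  have f1 : g z (H z (G z c)) (U z) = 0 := by rw [alg.symm, alg.gU, alg.u_H]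
  rw [f1, alg.HU, map_zero] at cyc
  simp only [zero_apply, mul_zero, add_zero] at cyc
  have t1 := h.christoffelForm_symm (G z b) (U z) (G z c)
  have t2 := h.christoffelForm_symm b (U z) c
  simp only [covEndForm, covVecForm, alg.GU, christoffelForm_zero_mid,
    alg.G_sq_of_horizontal uc vc, christoffelForm_neg_right] at e1 e2 e3 e4 cyc ⊢
  linarith

/-- On horizontal vectors `g(∇_a U, b) = g(a, G b)`. -/
theorem covVecForm_horizontal (h : NormalJet g u v σ U V G H z) {a b : E}
    (ua : u z a = 0) (va : v z a = 0) (ub : u z b = 0) (vb : v z b = 0) :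
    covVecForm g U z a b = g z a (G z b) := by
  have alg := h.algebra_self
  have e := h.covVecForm_G_G (alg.v_G a) (alg.u_G b) (alg.v_G b)
  rw [alg.G_sq_of_horizontal ua va, alg.G_sq_of_horizontal ub vb, covVecForm_neg,
    covVecForm_neg] at e
  have n : ∀ x y, covVecForm g U z (-x) y = -covVecForm g U z x y := fun x y => by
    rw [covVecForm, covVecForm, h.christoffelForm_symm, h.christoffelForm_symm x,
      christoffelForm_neg_mid, map_neg, map_neg, neg_apply]
    ring
  rw [n, n] at e
  have d := h.covVecForm_sub a b
  rw [va, vb] at d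
  linarith

end NormalJet
end FlatFormulas

/-! ### Vanishing of the second fundamental form in a chart -/

section FlatSubmanifold

variable {E : Type*} [NormedAddCommGroup E] [NormedSpace ℝ E]

namespace NormalJet

variable {g : E → E →L[ℝ] E →L[ℝ] ℝ} {u v σ : E → E →L[ℝ] ℝ} {U V : E → E}
  {G H : E → E →L[ℝ] E} {z : E}

theorem covEndForm_neg_field (g : E → E →L[ℝ] E →L[ℝ] ℝ) (H : E → E →L[ℝ] E) (z a b c : E) :
    covEndForm g (fun y => -H y) z a b c = -covEndForm g H z a b c := by
  simp only [covEndForm, fderiv_fun_neg, neg_apply, map_neg, christoffelForm_neg_mid,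
    christoffelForm_neg_right]
  ring

theorem covVecForm_neg_field (g : E → E →L[ℝ] E →L[ℝ] ℝ) (V : E → E) (z a b : E) :
    covVecForm g (fun y => -V y) z a b = -covVecForm g V z a b := by
  simp only [covVecForm, fderiv_fun_neg, neg_apply, map_neg, christoffelForm_neg_mid]
  ring

/-- A symmetric form `k(a, b, w) = g(∇_a b, w)`, with `a`, `b` tangent to a submanifold and `w` normal
to it, vanishes when the tangent space contains `U` and `V` and is invariant under `G` and `H`.  On
horizontal vectors `k` is complex bilinear with respect to both `G` and `H`; as these anticommute,
`k(Ga, Hb, ·)` is equal to its negative. -/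
theorem form_eq_zero (h : NormalJet g u v σ U V G H z)
    (h' : NormalJet g (fun y => -v y) u σ (fun y => -V y) U (fun y => -H y) G z)
    {P : Type*} [AddCommGroup P] [Module ℝ P] {T : P →ₗ[ℝ] E} {k : P → P → E → ℝ}
    (ksymm : ∀ a b w, k a b w = k b a w) (kadd : ∀ a a' b w, k (a + a') b w = k a b w + k a' b w)
    (ksmul : ∀ (c : ℝ) a b w, k (c • a) b w = c * k a b w) (kneg : ∀ a b w, k a b (-w) = -k a b w)
    (hU : ∃ p, T p = U z) (hV : ∃ p, T p = V z) (hG : ∀ a, ∃ b, T b = G z (T a))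
    (hH : ∀ a, ∃ b, T b = H z (T a))
    (kG : ∀ a b b' w, (∀ p, g z (T p) w = 0) → T b' = G z (T b) →
      k a b' w = covEndForm g G z (T a) (T b) w - k a b (G z w))
    (kH : ∀ a b b' w, (∀ p, g z (T p) w = 0) → T b' = H z (T b) →
      k a b' w = covEndForm g H z (T a) (T b) w - k a b (H z w))
    (kU : ∀ a p w, (∀ p, g z (T p) w = 0) → T p = U z → k a p w = covVecForm g U z (T a) w)
    (kV : ∀ a p w, (∀ p, g z (T p) w = 0) → T p = V z → k a p w = covVecForm g V z (T a) w)
    (a b : P) {w : E} (hw : ∀ p, g z (T p) w = 0) : k a b w = 0 := by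
  have alg := h.algebra_self
  obtain ⟨pU, hpU⟩ := hU
  obtain ⟨pV, hpV⟩ := hV
  have uw : ∀ w, (∀ p, g z (T p) w = 0) → u z w = 0 := fun w hw => by
    rw [← alg.gU, ← hpU, hw]
  have vw : ∀ w, (∀ p, g z (T p) w = 0) → v z w = 0 := fun w hw => by
    rw [← alg.gV, ← hpV, hw]
  have Gw : ∀ w, (∀ p, g z (T p) w = 0) → ∀ p, g z (T p) (G z w) = 0 := fun w hw p => by
    obtain ⟨b, hb⟩ := hG p
    rw [← neg_eq_zero, ← alg.G_skew, ← hb, hw]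
  have Hw : ∀ w, (∀ p, g z (T p) w = 0) → ∀ p, g z (T p) (H z w) = 0 := fun w hw p => by
    obtain ⟨b, hb⟩ := hH p
    rw [← neg_eq_zero, ← alg.H_skew, ← hb, hw]
  have covU {a w : E} (ua : u z a = 0) (va : v z a = 0) (uw : u z w = 0) (vw : v z w = 0) :
      covVecForm g U z a w = g z a (G z w) := h.covVecForm_horizontal ua va uw vw
  have covV {a w : E} (ua : u z a = 0) (va : v z a = 0) (uw : u z w = 0) (vw : v z w = 0) :
      covVecForm g V z a w = g z a (H z w) := by
    have := h'.covVecForm_horizontal (a := a) (b := w) (by simp [va]) ua (by simp [vw]) uw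
    rw [covVecForm_neg_field, neg_apply (H z) w, map_neg (g z a), neg_inj] at this
    exact this
  have subV (a b : E) : -covVecForm g V z a b + covVecForm g V z b a
      = -(2 * g z a (H z b)) + σ z a * u z b - σ z b * u z a := by
    have e := h'.covVecForm_sub a b
    rw [covVecForm_neg_field, covVecForm_neg_field, neg_apply (H z) b, map_neg (g z a)] at e
    linarith
  -- the vertical directions
  have kUh : ∀ a w, u z (T a) = 0 → v z (T a) = 0 → (∀ p, g z (T p) w = 0) → k a pU w = 0 :=
    fun a w ua va hw => by
      rw [kU a pU w hw hpU, covU ua va (uw w hw) (vw w hw), Gw w hw]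
  have kVh : ∀ a w, u z (T a) = 0 → v z (T a) = 0 → (∀ p, g z (T p) w = 0) → k a pV w = 0 :=
    fun a w ua va hw => by
      rw [kV a pV w hw hpV, covV ua va (uw w hw) (vw w hw), Hw w hw]
  have kUU : k pU pU w = 0 := by
    have e := h.covVecForm_sub (U z) w
    rw [h.covVecForm_U_self, alg.gU, alg.u_G, vw w hw, alg.vU] at e
    rw [kU _ _ _ hw hpU, hpU]
    linarith
  have kVV : k pV pV w = 0 := by
    have e := subV (V z) w
    have e' := h'.covVecForm_U_self w
    rw [covVecForm_neg_field, covVecForm_neg] at e'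
    rw [alg.gV, alg.v_H, uw w hw, alg.uV] at e
    rw [kV _ _ _ hw hpV, hpV]
    linarith
  have kUV : k pU pV w = 0 := by
    have e := h.covVecForm_sub (V z) w
    have e' := subV (U z) w
    have e1 := h.covVecForm_U_V w
    rw [alg.gV, alg.v_G, vw w hw, alg.vV] at e
    rw [alg.gU, alg.u_H, uw w hw, alg.uU] at e'
    have s := ksymm pU pV w
    rw [kV _ _ _ hw hpV, kU _ _ _ hw hpU, hpU, hpV] at s
    rw [kV _ _ _ hw hpV, hpU]
    linarith
  -- the horizontal directions
  have kGh : ∀ a b b' w, u z (T a) = 0 → v z (T a) = 0 → u z (T b) = 0 → v z (T b) = 0 →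
      (∀ p, g z (T p) w = 0) → T b' = G z (T b) → k a b' w = -k a b (G z w) := by
    intro a b b' w ua va ub vb hw hb
    obtain ⟨c, hc⟩ := hH b
    rw [kG a b b' w hw hb, h.covEndForm_horizontal ua va ub vb (uw w hw) (vw w hw), ← hc, hw]
    ring
  have kHh : ∀ a b b' w, u z (T a) = 0 → v z (T a) = 0 → u z (T b) = 0 → v z (T b) = 0 →
      (∀ p, g z (T p) w = 0) → T b' = H z (T b) → k a b' w = -k a b (H z w) := by
    intro a b b' w ua va ub vb hw hb
    obtain ⟨c, hc⟩ := hG b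
    have e := h'.covEndForm_horizontal (a := T a) (b := T b) (c := w) (by simp [va]) ua
      (by simp [vb]) ub (by simp [vw w hw]) (uw w hw)
    rw [covEndForm_neg_field, ← hc, hw] at e
    rw [kH a b b' w hw hb]
    linarith
  have khh : ∀ a b w, u z (T a) = 0 → v z (T a) = 0 → u z (T b) = 0 → v z (T b) = 0 →
      (∀ p, g z (T p) w = 0) → k a b (G z (H z w)) = 0 := by
    intro a b w ua va ub vb hw
    obtain ⟨a', ha'⟩ := hG a
    obtain ⟨b', hb'⟩ := hH b
    have ua' : u z (T a') = 0 := by rw [ha', alg.u_G]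
    have va' : v z (T a') = 0 := by rw [ha', alg.v_G]
    have ub' : u z (T b') = 0 := by rw [hb', alg.u_H]
    have vb' : v z (T b') = 0 := by rw [hb', alg.v_H]
    have e1 := kHh a' b b' w ua' va' ub vb hw hb'
    have e2 := kGh b a a' (H z w) ub vb ua va (Hw w hw) ha'
    have e3 := kGh b' a a' w ub' vb' ua va hw ha'
    have e4 := kHh a b b' (G z w) ua va ub vb (Gw w hw) hb'
    have e5 : k a b (H z (G z w)) = -k a b (G z (H z w)) := by rw [← kneg, alg.GH, neg_neg]
    have s1 := ksymm a' b' w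
    have s2 := ksymm a' b (H z w)
    have s3 := ksymm b' a (G z w)
    have s4 := ksymm a b (G z (H z w))
    linarith
  have kh : ∀ a b, u z (T a) = 0 → v z (T a) = 0 → u z (T b) = 0 → v z (T b) = 0 →
      k a b w = 0 := by
    intro a b ua va ub vb
    have e := khh a b (G z (H z w)) ua va ub vb (Gw _ (Hw w hw))
    have e' : G z (H z (G z (H z w))) = -w := by
      rw [alg.GH w, map_neg, alg.H_sq, alg.u_G, alg.v_G]
      simp [alg.G_sq_of_horizontal (uw w hw) (vw w hw)]
    rwa [e', kneg, neg_eq_zero] at e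
  -- decomposition into horizontal and vertical parts
  have dec : ∀ a, ∃ a₀, u z (T a₀) = 0 ∧ v z (T a₀) = 0 ∧
      a = a₀ + (u z (T a) • pU + v z (T a) • pV) := by
    intro a
    refine ⟨a - (u z (T a) • pU + v z (T a) • pV), ?_, ?_, by abel⟩ <;>
    simp [hpU, hpV, alg.uU, alg.uV, alg.vU, alg.vV]
  have kU0 : ∀ a, k a pU w = 0 := by
    intro a
    obtain ⟨a₀, ua, va, e⟩ := dec a
    rw [e, kadd, kadd, ksmul, ksmul, kUh a₀ w ua va hw, kUU, ksymm pV pU, kUV]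
    ring
  have kV0 : ∀ a, k a pV w = 0 := by
    intro a
    obtain ⟨a₀, ua, va, e⟩ := dec a
    rw [e, kadd, kadd, ksmul, ksmul, kVh a₀ w ua va hw, kUV, kVV]
    ring
  obtain ⟨a₀, ua, va, e⟩ := dec a
  obtain ⟨b₀, ub, vb, e'⟩ := dec b
  rw [e, kadd, kadd, ksmul, ksmul, ksymm pU, ksymm pV, kU0, kV0, e', ksymm a₀, kadd, kadd, ksmul,
    ksmul, ksymm pU, ksymm pV, kU0, kV0, kh b₀ a₀ ub vb ua va]
  ring

end NormalJet
end FlatSubmanifold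

section FlatImmersion

variable {E : Type*} [NormedAddCommGroup E] [NormedSpace ℝ E]
  {P : Type*} [NormedAddCommGroup P] [NormedSpace ℝ P]

/-- If a vector field `Φ` takes values in the ranges of an injective family of linear maps `T`, then
its derivative differs from that of `T b`, for the vector `b` with `T b = Φ` at the point, by a vector
in the range of `T`. -/
theorem fderiv_sub_fderiv_mem_range [FiniteDimensional ℝ E] [FiniteDimensional ℝ P]
    {Q : Type*} [NormedAddCommGroup Q] [NormedSpace ℝ Q] {T : Q → P →L[ℝ] E} {Φ : Q → E} {p : Q}
    (hT : DifferentiableAt ℝ T p) (hΦ : DifferentiableAt ℝ Φ p) (hinj : Function.Injective (T p))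
    (hmem : ∀ᶠ q in 𝓝 p, ∃ x, T q x = Φ q) {b : P} (hb : T p b = Φ p) (a : Q) :
    ∃ x, T p x = fderiv ℝ Φ p a - fderiv ℝ T p a b := by
  have : CompleteSpace P := FiniteDimensional.complete ℝ P
  obtain ⟨L₀, hL₀⟩ := (T p).toLinearMap.exists_leftInverse_of_injective
    (LinearMap.ker_eq_bot.2 hinj)
  let L : E →L[ℝ] P := L₀.toContinuousLinearMap
  have hL : ∀ x, L (T p x) = x := fun x => LinearMap.congr_fun hL₀ x
  let R : Q → P →L[ℝ] P := fun q => L.comp (T q)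
  have hR : R p = 1 := ContinuousLinearMap.ext hL
  have hRd : DifferentiableAt ℝ R p := (differentiableAt_const L).clm_comp hT
  have hinv : DifferentiableAt ℝ (fun q => Ring.inverse (R q)) p := by
    have : DifferentiableAt ℝ (Ring.inverse : (P →L[ℝ] P) → _) (R p) := by
      rw [hR]
      exact differentiableAt_inverse (𝕜 := ℝ) isUnit_one
    exact this.comp p hRd
  have hunit : ∀ᶠ q in 𝓝 p, IsUnit (R q) :=
    hRd.continuousAt.eventually (Units.isOpen.mem_nhds (hR ▸ isUnit_one))
  let c : Q → P := fun q => Ring.inverse (R q) (L (Φ q))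
  have hc : DifferentiableAt ℝ c p :=
    hinv.clm_apply ((differentiableAt_const L).clm_apply hΦ)
  have hcp : c p = b := by
    simp only [c, hR, Ring.inverse_one, ← hb, hL]
    rfl
  have key : Φ =ᶠ[𝓝 p] fun q => T q (c q) := by
    filter_upwards [hmem, hunit] with q ⟨x, hx⟩ hq
    have : c q = (Ring.inverse (R q) * R q) x := by
      simp only [c, ← hx]; rfl
    rw [this, Ring.inverse_mul_cancel _ hq, ← hx]
    rfl
  refine ⟨fderiv ℝ c p a, ?_⟩
  rw [key.fderiv_eq (𝕜 := ℝ), fderiv_clm_apply_apply hT hc, hcp]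
  abel

set_option synthInstance.maxHeartbeats 100000 in
/-- In charts: an immersion whose tangent spaces contain `U` and `V` and are invariant under `G` and
`H` has no second fundamental form. -/
theorem NormalJet.second_fundamental_form_eq_zero [FiniteDimensional ℝ E] [FiniteDimensional ℝ P]
    {g : E → E →L[ℝ] E →L[ℝ] ℝ} {u v σ : E → E →L[ℝ] ℝ} {U V : E → E} {G H : E → E →L[ℝ] E}
    {F : P → E} {p : P} (h : NormalJet g u v σ U V G H (F p))
    (h' : NormalJet g (fun y => -v y) u σ (fun y => -V y) U (fun y => -H y) G (F p))
    (hF : ContDiffAt ℝ 2 F p) (hinj : Function.Injective (fderiv ℝ F p))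
    (hU : ∀ᶠ q in 𝓝 p, ∃ x, fderiv ℝ F q x = U (F q))
    (hV : ∀ᶠ q in 𝓝 p, ∃ x, fderiv ℝ F q x = V (F q))
    (hG : ∀ᶠ q in 𝓝 p, ∀ b, ∃ x, fderiv ℝ F q x = G (F q) (fderiv ℝ F q b))
    (hH : ∀ᶠ q in 𝓝 p, ∀ b, ∃ x, fderiv ℝ F q x = H (F q) (fderiv ℝ F q b))
    (a b : P) {w : E} (hw : ∀ x, g (F p) (fderiv ℝ F p x) w = 0) :
    g (F p) (fderiv ℝ (fderiv ℝ F) p a b) w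
      + christoffelForm g (F p) (fderiv ℝ F p a) (fderiv ℝ F p b) w = 0 := by
  have hFd : DifferentiableAt ℝ F p := hF.differentiableAt (by norm_num)
  have hT : DifferentiableAt ℝ (fderiv ℝ F) p :=
    (hF.fderiv_right (m := 1) (by norm_num)).differentiableAt (by norm_num)
  have hsymm : ∀ x y, fderiv ℝ (fderiv ℝ F) p x y = fderiv ℝ (fderiv ℝ F) p y x :=
    hF.isSymmSndFDerivAt (by simp)
  have kend {A : E → E →L[ℝ] E} (hA : DifferentiableAt ℝ A (F p))
      (hskew : ∀ x y, g (F p) (A (F p) x) y = -g (F p) x (A (F p) y))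
      (hmem : ∀ᶠ q in 𝓝 p, ∀ b, ∃ x, fderiv ℝ F q x = A (F q) (fderiv ℝ F q b))
      {a b b' : P} {w : E} (hw : ∀ x, g (F p) (fderiv ℝ F p x) w = 0)
      (hb : fderiv ℝ F p b' = A (F p) (fderiv ℝ F p b)) :
      g (F p) (fderiv ℝ (fderiv ℝ F) p a b') w
        + christoffelForm g (F p) (fderiv ℝ F p a) (fderiv ℝ F p b') w
      = covEndForm g A (F p) (fderiv ℝ F p a) (fderiv ℝ F p b) w
        - (g (F p) (fderiv ℝ (fderiv ℝ F) p a b) (A (F p) w)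
          + christoffelForm g (F p) (fderiv ℝ F p a) (fderiv ℝ F p b) (A (F p) w)) := by
    have hAF : DifferentiableAt ℝ (fun q => A (F q)) p := hA.comp p hFd
    have hFb : DifferentiableAt ℝ (fun q => fderiv ℝ F q b) p :=
      hT.clm_apply (differentiableAt_const b)
    obtain ⟨x, hx⟩ := fderiv_sub_fderiv_mem_range hT (hAF.clm_apply hFb) hinj
      (hmem.mono fun q hq => hq b) hb a
    have hA' : fderiv ℝ (fun q => A (F q)) p = (fderiv ℝ A (F p)).comp (fderiv ℝ F p) :=
      fderiv_comp p hA hFd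
    rw [fderiv_clm_apply_apply hAF hFb, fderiv_clm_apply_const hT, hA'] at hx
    have e := hw x
    rw [hx] at e
    simp only [map_sub, map_add, sub_apply, add_apply, hskew] at e
    rw [covEndForm, hb]
    simp only [ContinuousLinearMap.comp_apply] at e
    linarith
  have kvec {X : E → E} (hX : DifferentiableAt ℝ X (F p))
      (hmem : ∀ᶠ q in 𝓝 p, ∃ x, fderiv ℝ F q x = X (F q))
      {a b' : P} {w : E} (hw : ∀ x, g (F p) (fderiv ℝ F p x) w = 0)
      (hb : fderiv ℝ F p b' = X (F p)) :
      g (F p) (fderiv ℝ (fderiv ℝ F) p a b') w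
        + christoffelForm g (F p) (fderiv ℝ F p a) (fderiv ℝ F p b') w
      = covVecForm g X (F p) (fderiv ℝ F p a) w := by
    have hXF : DifferentiableAt ℝ (fun q => X (F q)) p := hX.comp p hFd
    obtain ⟨x, hx⟩ := fderiv_sub_fderiv_mem_range hT hXF hinj hmem hb a
    have hX' : fderiv ℝ (fun q => X (F q)) p = (fderiv ℝ X (F p)).comp (fderiv ℝ F p) :=
      fderiv_comp p hX hFd
    have e := hw x
    rw [hx, hX'] at e
    simp only [map_sub, sub_apply, ContinuousLinearMap.comp_apply] at e
    rw [covVecForm, hb]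
    linarith
  have alg := h.algebra_self
  refine h.form_eq_zero h' (T := (fderiv ℝ F p).toLinearMap)
    (k := fun a b w => g (F p) (fderiv ℝ (fderiv ℝ F) p a b) w
      + christoffelForm g (F p) (fderiv ℝ F p a) (fderiv ℝ F p b) w)
    ?_ ?_ ?_ ?_ hU.self_of_nhds hV.self_of_nhds hG.self_of_nhds hH.self_of_nhds
    (fun a b b' w hw hb => kend h.diff_G alg.G_skew hG hw hb)
    (fun a b b' w hw hb => kend h.diff_H alg.H_skew hH hw hb)
    (fun a b w hw hb => kvec h.diff_U hU hw hb)
    (fun a b w hw hb => kvec h.diff_V hV hw hb) a b hw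
  · intro a b w
    rw [hsymm a b, h.christoffelForm_symm]
  · intro a a' b w
    simp only [christoffelForm, map_add, add_apply]
    ring
  · intro c a b w
    simp only [christoffelForm, map_smul, smul_apply, smul_eq_mul]
    ring
  · intro a b w
    simp only [christoffelForm_neg_right, map_neg]
    ring

end FlatImmersion

/-! ### Expressions of tensor fields in a chart -/

section Chart

variable {E : Type*} [NormedAddCommGroup E] [NormedSpace ℝ E]
  {M : Type*} [TopologicalSpace M] [ChartedSpace E M]

/-- The derivative of a function at a point of the domain of a chart, computed in the chart. -/
theorem mvfderiv_eq_fderiv_chart [IsManifold 𝓘(ℝ, E) 1 M] {F : Type*} [NormedAddCommGroup F]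
    [NormedSpace ℝ F] {h : M → F} {x₀ y : M} (hy : y ∈ (chartAt E x₀).source)
    (hd : DifferentiableAt ℝ (h ∘ (extChartAt 𝓘(ℝ, E) x₀).symm) (extChartAt 𝓘(ℝ, E) x₀ y))
    (w : TangentSpace 𝓘(ℝ, E) y) :
    mvfderiv 𝓘(ℝ, E) h y w = fderiv ℝ (h ∘ (extChartAt 𝓘(ℝ, E) x₀).symm)
      (extChartAt 𝓘(ℝ, E) x₀ y) (mfderiv 𝓘(ℝ, E) 𝓘(ℝ, E) (extChartAt 𝓘(ℝ, E) x₀) y w) := by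
  have hφ : MDifferentiableAt 𝓘(ℝ, E) 𝓘(ℝ, E) (extChartAt 𝓘(ℝ, E) x₀) y :=
    mdifferentiableAt_extChartAt hy
  have key : h =ᶠ[𝓝 y] (h ∘ (extChartAt 𝓘(ℝ, E) x₀).symm) ∘ extChartAt 𝓘(ℝ, E) x₀ := by
    filter_upwards [(chartAt E x₀).open_source.mem_nhds hy] with q hq
    simp only [Function.comp_apply]
    rw [(extChartAt 𝓘(ℝ, E) x₀).left_inv (by rwa [extChartAt_source])]
  have e : mfderiv 𝓘(ℝ, E) 𝓘(ℝ, F) h y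
      = mfderiv 𝓘(ℝ, E) 𝓘(ℝ, F) ((h ∘ (extChartAt 𝓘(ℝ, E) x₀).symm) ∘ extChartAt 𝓘(ℝ, E) x₀) y :=
    key.mfderiv_eq
  have e2 := mfderiv_comp y hd.mdifferentiableAt hφ
  rw [mfderiv_eq_fderiv] at e2
  change mfderiv 𝓘(ℝ, E) 𝓘(ℝ, F) h y w = _
  rw [e, e2]
  rfl

/-- A map that is smooth at the centre of a chart is smooth in the chart. -/
theorem contDiffAt_comp_extChartAt_symm {F : Type*} [NormedAddCommGroup F] [NormedSpace ℝ F]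
    {k : ℕ∞ω} {h : M → F} {x₀ : M} (hh : ContMDiffAt 𝓘(ℝ, E) 𝓘(ℝ, F) k h x₀) :
    ContDiffAt ℝ k (h ∘ (extChartAt 𝓘(ℝ, E) x₀).symm) (extChartAt 𝓘(ℝ, E) x₀ x₀) := by
  have := (contMDiffAt_iff.1 hh).2
  simpa using! this

theorem eventually_chart_source (x₀ : M) : ∀ᶠ z in 𝓝 (extChartAt 𝓘(ℝ, E) x₀ x₀),
    (extChartAt 𝓘(ℝ, E) x₀).symm z ∈ (chartAt E x₀).source := by
  filter_upwards [extChartAt_target_mem_nhds (I := 𝓘(ℝ, E)) x₀] with z hz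
  simpa using (extChartAt 𝓘(ℝ, E) x₀).map_target hz

theorem eventually_mem_of_isOpen {x₀ : M} {O : Set M} (hO : IsOpen O) (hx : x₀ ∈ O) :
    ∀ᶠ z in 𝓝 (extChartAt 𝓘(ℝ, E) x₀ x₀), (extChartAt 𝓘(ℝ, E) x₀).symm z ∈ O := by
  refine (continuousAt_extChartAt_symm x₀).eventually ?_
  rw [extChartAt_to_inv x₀]
  exact hO.mem_nhds hx

variable [IsManifold 𝓘(ℝ, E) ω M]

variable (E) in
/-- The coordinates of tangent vectors at `y` in the chart at `x₀`. -/
def toChart (x₀ y : M) : TangentSpace 𝓘(ℝ, E) y →L[ℝ] E :=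
  (trivializationAt E (TangentSpace 𝓘(ℝ, E)) x₀).continuousLinearMapAt ℝ y

variable (E) in
/-- The tangent vector at `y` with given coordinates in the chart at `x₀`. -/
def ofChart (x₀ y : M) : E →L[ℝ] TangentSpace 𝓘(ℝ, E) y :=
  (trivializationAt E (TangentSpace 𝓘(ℝ, E)) x₀).symmL ℝ y

theorem mem_baseSet_tangent {x₀ y : M} (hy : y ∈ (chartAt E x₀).source) :
    y ∈ (trivializationAt E (TangentSpace 𝓘(ℝ, E)) x₀).baseSet := by
  rwa [TangentBundle.trivializationAt_baseSet]

theorem toChart_ofChart {x₀ y : M} (hy : y ∈ (chartAt E x₀).source) (a : E) :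
    toChart E x₀ y (ofChart E x₀ y a) = a :=
  (trivializationAt E (TangentSpace 𝓘(ℝ, E)) x₀).continuousLinearMapAt_symmL
    (mem_baseSet_tangent hy) a

theorem ofChart_toChart {x₀ y : M} (hy : y ∈ (chartAt E x₀).source) (w : TangentSpace 𝓘(ℝ, E) y) :
    ofChart E x₀ y (toChart E x₀ y w) = w :=
  (trivializationAt E (TangentSpace 𝓘(ℝ, E)) x₀).symmL_continuousLinearMapAt
    (mem_baseSet_tangent hy) w

theorem toChart_eq_mfderiv {x₀ y : M} (hy : y ∈ (chartAt E x₀).source) :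
    toChart E x₀ y = mfderiv 𝓘(ℝ, E) 𝓘(ℝ, E) (extChartAt 𝓘(ℝ, E) x₀) y :=
  TangentBundle.continuousLinearMapAt_trivializationAt hy

theorem toChart_self (x₀ : M) (w : TangentSpace 𝓘(ℝ, E) x₀) : toChart E x₀ x₀ w = w := by
  rw [toChart_eq_mfderiv (mem_chart_source E x₀), mfderiv_extChartAt_self]
  rfl

theorem ofChart_self (x₀ : M) (w : TangentSpace 𝓘(ℝ, E) x₀) : ofChart E x₀ x₀ w = w := by
  rw [← toChart_self x₀ (ofChart E x₀ x₀ w)]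
  exact toChart_ofChart (mem_chart_source E x₀) w

/-- A vector field in the chart at `x₀`. -/
def chartVec (x₀ : M) (X : VField ℝ E M) (z : E) : E :=
  toChart E x₀ ((extChartAt 𝓘(ℝ, E) x₀).symm z) (X ((extChartAt 𝓘(ℝ, E) x₀).symm z))

/-- A one-form in the chart at `x₀`. -/
def chartForm (x₀ : M) (α : OneForm ℝ E M) (z : E) : E →L[ℝ] ℝ :=
  (α ((extChartAt 𝓘(ℝ, E) x₀).symm z)).comp (ofChart E x₀ ((extChartAt 𝓘(ℝ, E) x₀).symm z))

/-- A `(1,1)`-tensor field in the chart at `x₀`. -/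
def chartEnd (x₀ : M) (A : EndField ℝ E M) (z : E) : E →L[ℝ] E :=
  (toChart E x₀ ((extChartAt 𝓘(ℝ, E) x₀).symm z)).comp
    ((A ((extChartAt 𝓘(ℝ, E) x₀).symm z)).comp (ofChart E x₀ ((extChartAt 𝓘(ℝ, E) x₀).symm z)))

/-- A metric in the chart at `x₀`. -/
def chartMetric (x₀ : M) (g : SemiRiemannianMetric E M) (z : E) : E →L[ℝ] E →L[ℝ] ℝ :=
  (ContinuousLinearMap.precomp ℝ (ofChart E x₀ ((extChartAt 𝓘(ℝ, E) x₀).symm z))).comp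
    ((g.val ((extChartAt 𝓘(ℝ, E) x₀).symm z)).comp
      (ofChart E x₀ ((extChartAt 𝓘(ℝ, E) x₀).symm z)))

theorem VField.SmoothOn.contDiffAt_chartVec {X : VField ℝ E M} {O : Set M} {x₀ : M} {k : ℕ∞ω}
    (hX : X.SmoothOn k O) (hO : IsOpen O) (hx : x₀ ∈ O) :
    ContDiffAt ℝ k (chartVec x₀ X) (extChartAt 𝓘(ℝ, E) x₀ x₀) := by
  have h1 := contMDiffAt_section x₀ |>.1 ((hX x₀ hx).contMDiffAt (hO.mem_nhds hx))
  refine (contDiffAt_comp_extChartAt_symm h1).congr_of_eventuallyEq ?_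
  filter_upwards [eventually_chart_source x₀] with z hz
  simp only [chartVec, toChart, Function.comp_apply]
  rw [Trivialization.continuousLinearMapAt_apply,
    Trivialization.coe_linearMapAt_of_mem _ (mem_baseSet_tangent hz)]

theorem OneForm.SmoothOn.contDiffAt_chartForm {α : OneForm ℝ E M} {O : Set M} {x₀ : M} {k : ℕ∞ω}
    (hα : α.SmoothOn k O) (hO : IsOpen O) (hx : x₀ ∈ O) :
    ContDiffAt ℝ k (chartForm x₀ α) (extChartAt 𝓘(ℝ, E) x₀ x₀) := by
  have h1 := (contMDiffAt_hom_bundle _).1 ((hα x₀ hx).contMDiffAt (hO.mem_nhds hx)) |>.2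
  refine (contDiffAt_comp_extChartAt_symm h1).congr_of_eventuallyEq ?_
  filter_upwards [eventually_chart_source x₀] with z hz
  ext a
  simp [chartForm, ofChart, Function.comp_apply, ContinuousLinearMap.inCoordinates]
  rfl

theorem EndField.SmoothOn.contDiffAt_chartEnd {A : EndField ℝ E M} {O : Set M} {x₀ : M} {k : ℕ∞ω}
    (hA : A.SmoothOn k O) (hO : IsOpen O) (hx : x₀ ∈ O) :
    ContDiffAt ℝ k (chartEnd x₀ A) (extChartAt 𝓘(ℝ, E) x₀ x₀) := by
  have h1 := (contMDiffAt_hom_bundle _).1 ((hA x₀ hx).contMDiffAt (hO.mem_nhds hx)) |>.2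
  exact contDiffAt_comp_extChartAt_symm h1

theorem SemiRiemannianMetric.contDiffAt_chartMetric (g : SemiRiemannianMetric E M) (x₀ : M) :
    ContDiffAt ℝ ∞ (chartMetric x₀ g) (extChartAt 𝓘(ℝ, E) x₀ x₀) := by
  have h1 := (contMDiffAt_hom_bundle _).1 (g.smooth x₀) |>.2
  refine (contDiffAt_comp_extChartAt_symm h1).congr_of_eventuallyEq ?_
  filter_upwards [eventually_chart_source x₀] with z hz
  ext a b
  simp only [Function.comp_apply]
  rw [inCoordinates_apply_eq₂ (mem_baseSet_tangent hz) (mem_baseSet_tangent hz) (by simp)]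
  rw [← Trivialization.symmL_apply (R := ℝ) _ (mem_baseSet_tangent hz),
    ← Trivialization.symmL_apply (R := ℝ) _ (mem_baseSet_tangent hz)]
  rw [Trivialization.coe_linearMapAt_of_mem _ (by simp)]
  rfl

end Chart

section ChartCalculus

variable {E : Type*} [NormedAddCommGroup E] [NormedSpace ℝ E]
  {M : Type*} [TopologicalSpace M] [ChartedSpace E M] [IsManifold 𝓘(ℝ, E) ω M]

theorem chartVec_self (x₀ : M) (X : VField ℝ E M) :
    chartVec x₀ X (extChartAt 𝓘(ℝ, E) x₀ x₀) = X x₀ := by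
  simp only [chartVec]
  rw [extChartAt_to_inv x₀]
  exact toChart_self x₀ (X x₀)

theorem chartForm_self (x₀ : M) (α : OneForm ℝ E M) (a : TangentSpace 𝓘(ℝ, E) x₀) :
    chartForm x₀ α (extChartAt 𝓘(ℝ, E) x₀ x₀) a = α x₀ a := by
  simp only [chartForm]
  rw [extChartAt_to_inv x₀]
  exact congrArg (α x₀) (ofChart_self x₀ a)

theorem chartEnd_self (x₀ : M) (A : EndField ℝ E M) (a : TangentSpace 𝓘(ℝ, E) x₀) :
    chartEnd x₀ A (extChartAt 𝓘(ℝ, E) x₀ x₀) a = A x₀ a := by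
  simp only [chartEnd]
  rw [extChartAt_to_inv x₀]
  exact (toChart_self x₀ _).trans (congrArg (A x₀) (ofChart_self x₀ a))

theorem chartMetric_self (x₀ : M) (g : SemiRiemannianMetric E M)
    (a b : TangentSpace 𝓘(ℝ, E) x₀) :
    chartMetric x₀ g (extChartAt 𝓘(ℝ, E) x₀ x₀) a b = g.val x₀ a b := by
  simp only [chartMetric]
  rw [extChartAt_to_inv x₀]
  change g.val x₀ (ofChart E x₀ x₀ a) (ofChart E x₀ x₀ b) = _
  rw [ofChart_self, ofChart_self]

theorem chartEnd_chartVec (x₀ : M) (A : EndField ℝ E M) (X : VField ℝ E M) :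
    chartVec x₀ (fun y => A y (X y)) =ᶠ[𝓝 (extChartAt 𝓘(ℝ, E) x₀ x₀)]
      fun z => chartEnd x₀ A z (chartVec x₀ X z) := by
  filter_upwards [eventually_chart_source x₀] with z hz
  change _ = toChart E x₀ _ (A _ (ofChart E x₀ _ (toChart E x₀ _ _)))
  rw [ofChart_toChart hz]
  rfl

/-- The vector field with constant components `a` in the chart at `x₀`. -/
def coordField (x₀ : M) (a : E) : VField ℝ E M := fun y => ofChart E x₀ y a

theorem smoothOn_coordField (x₀ : M) (a : E) {k : ℕ∞ω} :
    (coordField x₀ a).SmoothOn k (chartAt E x₀).source := by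
  intro y hy
  refine ContMDiffAt.contMDiffWithinAt ?_
  refine ((trivializationAt E (TangentSpace 𝓘(ℝ, E)) x₀).contMDiffAt_section_iff
    (mem_baseSet_tangent hy)).2 ?_
  refine (contMDiffAt_const (c := a)).congr_of_eventuallyEq ?_
  filter_upwards [(chartAt E x₀).open_source.mem_nhds hy] with q hq
  have := toChart_ofChart hq a
  rwa [toChart, Trivialization.continuousLinearMapAt_apply,
    Trivialization.coe_linearMapAt_of_mem _ (mem_baseSet_tangent hq)] at this

/-- The derivative of a function, computed in the chart at `x₀`. -/
theorem mvfderiv_eq_fderiv_toChart {F : Type*} [NormedAddCommGroup F] [NormedSpace ℝ F] {h : M → F}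
    {x₀ y : M} (hy : y ∈ (chartAt E x₀).source)
    (hd : DifferentiableAt ℝ (h ∘ (extChartAt 𝓘(ℝ, E) x₀).symm) (extChartAt 𝓘(ℝ, E) x₀ y))
    (w : TangentSpace 𝓘(ℝ, E) y) :
    mvfderiv 𝓘(ℝ, E) h y w = fderiv ℝ (h ∘ (extChartAt 𝓘(ℝ, E) x₀).symm)
      (extChartAt 𝓘(ℝ, E) x₀ y) (toChart E x₀ y w) := by
  rw [mvfderiv_eq_fderiv_chart hy hd w, toChart_eq_mfderiv hy]
  rfl

theorem inverse_toChart {x₀ y : M} (hy : y ∈ (chartAt E x₀).source) :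
    (toChart E x₀ y).inverse = ofChart E x₀ y :=
  ContinuousLinearMap.inverse_eq (ContinuousLinearMap.ext (toChart_ofChart hy))
    (ContinuousLinearMap.ext (ofChart_toChart hy))

theorem inverse_ofChart {x₀ y : M} (hy : y ∈ (chartAt E x₀).source) :
    (ofChart E x₀ y).inverse = toChart E x₀ y :=
  ContinuousLinearMap.inverse_eq (ContinuousLinearMap.ext (ofChart_toChart hy))
    (ContinuousLinearMap.ext (toChart_ofChart hy))

theorem mpullback_extChartAt {x₀ y : M} (hy : y ∈ (chartAt E x₀).source)
    (Z : Π z : E, TangentSpace 𝓘(ℝ, E) z) :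
    VectorField.mpullback 𝓘(ℝ, E) 𝓘(ℝ, E) (extChartAt 𝓘(ℝ, E) x₀) Z y
      = ofChart E x₀ y (Z (extChartAt 𝓘(ℝ, E) x₀ y)) := by
  have : (mfderiv 𝓘(ℝ, E) 𝓘(ℝ, E) (extChartAt 𝓘(ℝ, E) x₀) y).inverse = ofChart E x₀ y := by
    rw [← inverse_toChart hy, toChart_eq_mfderiv hy]
    rfl
  exact congrArg (fun L => L (Z _)) this

theorem bracket_coordField [CompleteSpace E] {x₀ y : M} (hy : y ∈ (chartAt E x₀).source)
    (a b : E) : bracket (coordField x₀ a) (coordField x₀ b) y = 0 := by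
  -- coordinate fields are the pullbacks of constant fields
  have e (c : Π z : E, TangentSpace 𝓘(ℝ, E) z) (a : E) (hc : ∀ z, c z = a) :
      VectorField.mpullback 𝓘(ℝ, E) 𝓘(ℝ, E) (extChartAt 𝓘(ℝ, E) x₀) c =ᶠ[𝓝 y] coordField x₀ a := by
    filter_upwards [(chartAt E x₀).open_source.mem_nhds hy] with q hq
    rw [mpullback_extChartAt hq, hc]
    rfl
  have hφ : ContMDiffAt 𝓘(ℝ, E) 𝓘(ℝ, E) ω (extChartAt 𝓘(ℝ, E) x₀) y :=
    contMDiffAt_extChartAt' hy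
  have hc (c : Π z : E, TangentSpace 𝓘(ℝ, E) z) (a : E) (hc : ∀ z, c z = a) :
      MDifferentiableAt 𝓘(ℝ, E) 𝓘(ℝ, E).tangent
      (fun z : E => (⟨z, c z⟩ : TangentBundle 𝓘(ℝ, E) E)) (extChartAt 𝓘(ℝ, E) x₀ y) := by
    have : ContMDiffAt 𝓘(ℝ, E) 𝓘(ℝ, E).tangent 1
        (fun z : E => (⟨z, c z⟩ : TangentBundle 𝓘(ℝ, E) E)) (extChartAt 𝓘(ℝ, E) x₀ y) := by
      refine contMDiffAt_vectorSpace_iff_contDiffAt.2 ?_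
      obtain rfl : c = fun _ => a := funext hc
      exact contDiffAt_const
    exact this.mdifferentiableAt (by norm_num)
  let A : Π z : E, TangentSpace 𝓘(ℝ, E) z := fun _ => a
  let B : Π z : E, TangentSpace 𝓘(ℝ, E) z := fun _ => b
  have h0 : VectorField.mlieBracket 𝓘(ℝ, E) A B (extChartAt 𝓘(ℝ, E) x₀ y) = 0 := by
    rw [← VectorField.mlieBracketWithin_univ, VectorField.mlieBracketWithin_eq_lieBracketWithin,
      VectorField.lieBracketWithin_univ]
    change fderiv ℝ (fun _ : E => b) _ _ - fderiv ℝ (fun _ : E => a) _ _ = 0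
    simp
  have := VectorField.mpullback_mlieBracket (hc A a fun _ => rfl) (hc B b fun _ => rfl) hφ (by simp)
  rw [(e A a fun _ => rfl).mlieBracket_vectorField_eq (e B b fun _ => rfl),
    mpullback_extChartAt hy, h0] at this
  rw [bracket, ← this]
  exact map_zero (ofChart E x₀ y)

/-- The Lie bracket at the centre of a chart. -/
theorem bracket_self (x₀ : M) (X Y : VField ℝ E M) :
    bracket X Y x₀ = fderiv ℝ (chartVec x₀ Y) (extChartAt 𝓘(ℝ, E) x₀ x₀) (X x₀)
      - fderiv ℝ (chartVec x₀ X) (extChartAt 𝓘(ℝ, E) x₀ x₀) (Y x₀) := by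
  have e (Z : VField ℝ E M) : VectorField.mpullbackWithin 𝓘(ℝ, E) 𝓘(ℝ, E)
      (extChartAt 𝓘(ℝ, E) x₀).symm Z (range 𝓘(ℝ, E)) =ᶠ[𝓝 (extChartAt 𝓘(ℝ, E) x₀ x₀)]
      chartVec x₀ Z := by
    filter_upwards [eventually_chart_source x₀, extChartAt_target_mem_nhds (I := 𝓘(ℝ, E)) x₀]
      with z hz hz'
    have hs := TangentBundle.symmL_trivializationAt (I := 𝓘(ℝ, E)) hz
    rw [(extChartAt 𝓘(ℝ, E) x₀).right_inv hz'] at hs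
    rw [VectorField.mpullbackWithin_apply, ← hs]
    exact congrArg (fun L => L (Z _)) (inverse_ofChart hz)
  rw [bracket, VectorField.mlieBracket, VectorField.mlieBracketWithin]
  refine (mpullback_extChartAt (mem_chart_source E x₀) _).trans ((ofChart_self x₀ _).trans ?_)
  have key (P Q : E → E) (hP : P =ᶠ[𝓝 (extChartAt 𝓘(ℝ, E) x₀ x₀)] chartVec x₀ X)
      (hQ : Q =ᶠ[𝓝 (extChartAt 𝓘(ℝ, E) x₀ x₀)] chartVec x₀ Y) :
      VectorField.lieBracketWithin ℝ P Q univ (extChartAt 𝓘(ℝ, E) x₀ x₀)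
      = fderiv ℝ (chartVec x₀ Y) (extChartAt 𝓘(ℝ, E) x₀ x₀) (X x₀)
      - fderiv ℝ (chartVec x₀ X) (extChartAt 𝓘(ℝ, E) x₀ x₀) (Y x₀) := by
    rw [VectorField.lieBracketWithin_univ, hP.lieBracket_vectorField_eq hQ,
      VectorField.lieBracket, chartVec_self, chartVec_self]
  rw [preimage_univ, univ_inter, show range 𝓘(ℝ, E) = univ by simp]
  rw [show range 𝓘(ℝ, E) = univ by simp] at e
  exact key _ _ (e X) (e Y)

/-- The exterior derivative on coordinate fields. -/
theorem extDer_coordField [CompleteSpace E] {α : OneForm ℝ E M} {O : Set M} {x₀ : M}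
    (hα : α.SmoothOn ∞ O) (hO : IsOpen O) (hx : x₀ ∈ O) :
    ∀ᶠ z in 𝓝 (extChartAt 𝓘(ℝ, E) x₀ x₀), ∀ a b,
      extDer α (coordField x₀ a) (coordField x₀ b) ((extChartAt 𝓘(ℝ, E) x₀).symm z)
      = (1 / 2) * (fderiv ℝ (chartForm x₀ α) z a b - fderiv ℝ (chartForm x₀ α) z b a) := by
  have hd : ContDiffAt ℝ 1 (chartForm x₀ α) (extChartAt 𝓘(ℝ, E) x₀ x₀) :=
    (hα.contDiffAt_chartForm hO hx).of_le (by norm_cast)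
  filter_upwards [eventually_chart_source x₀, extChartAt_target_mem_nhds (I := 𝓘(ℝ, E)) x₀,
    hd.eventually (by simp)] with z hz hz' hdz a b
  have key (a b : E) : mvfderiv 𝓘(ℝ, E) (fun y => α y (coordField x₀ b y))
      ((extChartAt 𝓘(ℝ, E) x₀).symm z) (coordField x₀ a ((extChartAt 𝓘(ℝ, E) x₀).symm z))
      = fderiv ℝ (chartForm x₀ α) z a b := by
    have hz1 : DifferentiableAt ℝ (chartForm x₀ α) z := hdz.differentiableAt (by norm_num)
    have e : (fun y => α y (coordField x₀ b y)) ∘ (extChartAt 𝓘(ℝ, E) x₀).symm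
        = fun z => chartForm x₀ α z b := rfl
    have hw : toChart E x₀ _ (coordField x₀ a ((extChartAt 𝓘(ℝ, E) x₀).symm z)) = a :=
      toChart_ofChart hz a
    have hz2 : DifferentiableAt ℝ ((fun y => α y (coordField x₀ b y)) ∘
        (extChartAt 𝓘(ℝ, E) x₀).symm) z := hz1.clm_apply (differentiableAt_const b)
    rw [← (extChartAt 𝓘(ℝ, E) x₀).right_inv hz'] at hz2
    rw [mvfderiv_eq_fderiv_toChart hz hz2, hw, e, (extChartAt 𝓘(ℝ, E) x₀).right_inv hz',
      fderiv_clm_apply_const hz1]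
  rw [extDer, key, key, bracket_coordField hz, map_zero, sub_zero]

/-- The Nijenhuis tensor at the centre of a chart. -/
theorem nijenhuis_self {A : EndField ℝ E M} {X Y : VField ℝ E M} {O : Set M} {x₀ : M}
    (hA : A.SmoothOn ∞ O) (hX : X.SmoothOn ∞ O) (hY : Y.SmoothOn ∞ O) (hO : IsOpen O)
    (hx : x₀ ∈ O) {a b : E} (ha : X x₀ = a) (hb : Y x₀ = b) {B : E → E →L[ℝ] E}
    (hB : chartEnd x₀ A = B) {z : E} (hz : extChartAt 𝓘(ℝ, E) x₀ x₀ = z) :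
    @Eq E (nijenhuis A X Y x₀)
      (fderiv ℝ B z (B z a) b - fderiv ℝ B z (B z b) a + B z (fderiv ℝ B z b a)
        - B z (fderiv ℝ B z a b)) := by
  subst hB hz
  have hA' : DifferentiableAt ℝ (chartEnd x₀ A) (extChartAt 𝓘(ℝ, E) x₀ x₀) :=
    (hA.contDiffAt_chartEnd hO hx).differentiableAt (by simp)
  have key {Z : VField ℝ E M} (hZ : Z.SmoothOn ∞ O) {c : E} (hc : Z x₀ = c) (a : E) :
      fderiv ℝ (chartVec x₀ fun y => A y (Z y)) (extChartAt 𝓘(ℝ, E) x₀ x₀) a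
      = fderiv ℝ (chartEnd x₀ A) (extChartAt 𝓘(ℝ, E) x₀ x₀) a c
        + chartEnd x₀ A (extChartAt 𝓘(ℝ, E) x₀ x₀)
          (fderiv ℝ (chartVec x₀ Z) (extChartAt 𝓘(ℝ, E) x₀ x₀) a) := by
    have hZ' : DifferentiableAt ℝ (chartVec x₀ Z) (extChartAt 𝓘(ℝ, E) x₀ x₀) :=
      (hZ.contDiffAt_chartVec hO hx).differentiableAt (by simp)
    have hc' : chartVec x₀ Z (extChartAt 𝓘(ℝ, E) x₀ x₀) = c := (chartVec_self x₀ Z).trans hc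
    rw [(chartEnd_chartVec x₀ A Z).fderiv_eq, fderiv_clm_apply_apply hA' hZ', hc']
  have hA0 (w : E) : @Eq E (A x₀ w) (chartEnd x₀ A (extChartAt 𝓘(ℝ, E) x₀ x₀) w) :=
    (chartEnd_self x₀ A w).symm
  have br (Z W : VField ℝ E M) {c d : E} (hc : Z x₀ = c) (hd : W x₀ = d) :
      @Eq E (bracket Z W x₀) (fderiv ℝ (chartVec x₀ W) (extChartAt 𝓘(ℝ, E) x₀ x₀) c
        - fderiv ℝ (chartVec x₀ Z) (extChartAt 𝓘(ℝ, E) x₀ x₀) d) := by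
    subst hc hd
    exact bracket_self x₀ Z W
  have hAX : (fun y => A y (X y)) x₀ = chartEnd x₀ A (extChartAt 𝓘(ℝ, E) x₀ x₀) a := by
    rw [← hA0, ← ha]
  have hAY : (fun y => A y (Y y)) x₀ = chartEnd x₀ A (extChartAt 𝓘(ℝ, E) x₀ x₀) b := by
    rw [← hA0, ← hb]
  have aux (L : E → E) {p q r s p' q' r' s' : E}
      (hL : ∀ w, L w = chartEnd x₀ A (extChartAt 𝓘(ℝ, E) x₀ x₀) w) (hp : p = p') (hq : q = q')
      (hr : r = r') (hs : s = s') : L (L p) + q - L r - L s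
        = chartEnd x₀ A (extChartAt 𝓘(ℝ, E) x₀ x₀) (chartEnd x₀ A (extChartAt 𝓘(ℝ, E) x₀ x₀) p')
          + q' - chartEnd x₀ A (extChartAt 𝓘(ℝ, E) x₀ x₀) r'
          - chartEnd x₀ A (extChartAt 𝓘(ℝ, E) x₀ x₀) s' := by
    subst hp hq hr hs
    simp only [hL]
  refine (aux (fun w => A x₀ w) hA0 (br X Y ha hb) (br _ _ hAX hAY) (br _ _ hAX hb)
    (br _ _ ha hAY)).trans ?_
  rw [key hX ha, key hX ha, key hY hb, key hY hb]
  simp only [map_sub, map_add]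
  abel

end ChartCalculus

/-! ### The chart expression of a normal complex contact metric structure -/

/-- Transport of the pointwise identities along a linear isomorphism `e` with inverse `d`. -/
theorem ContactAlgebra.conj {E : Type*} [NormedAddCommGroup E] [NormedSpace ℝ E]
    {g : E →L[ℝ] E →L[ℝ] ℝ} {u v : E →L[ℝ] ℝ} {U V : E} {G H : E →L[ℝ] E}
    (h : ContactAlgebra g u v U V G H) {e d : E →L[ℝ] E} (hed : ∀ a, e (d a) = a)
    (hde : ∀ a, d (e a) = a) :
    ContactAlgebra ((ContinuousLinearMap.precomp ℝ e).comp (g.comp e)) (u.comp e) (v.comp e) (d U)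
      (d V) (d.comp (G.comp e)) (d.comp (H.comp e)) where
  symm a b := h.symm _ _
  gU a := (congrArg (fun w => g w (e a)) (hed U)).trans (h.gU _)
  gV a := (congrArg (fun w => g w (e a)) (hed V)).trans (h.gV _)
  uU := (congrArg u (hed U)).trans h.uU
  vV := (congrArg v (hed V)).trans h.vV
  uV := (congrArg u (hed V)).trans h.uV
  vU := (congrArg v (hed U)).trans h.vU
  GU := by simp [hed, h.GU]
  GV := by simp [hed, h.GV]
  HU := by simp [hed, h.HU]
  HV := by simp [hed, h.HV]
  G_sq a := by simp [hed, hde, h.G_sq]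
  H_sq a := by simp [hed, hde, h.H_sq]
  GH a := by simp [hed, h.GH]
  G_skew a b := by
    change g (e (d (G (e a)))) (e b) = -g (e a) (e (d (G (e b))))
    rw [hed, hed, h.G_skew]
  H_skew a b := by
    change g (e (d (H (e a)))) (e b) = -g (e a) (e (d (H (e b))))
    rw [hed, hed, h.H_skew]

section Structure

variable {E : Type*} [NormedAddCommGroup E] [NormedSpace ℂ E]
  {M : Type*} [TopologicalSpace M] [ChartedSpace E M]

theorem J_J {x : M} (a : TangentSpace 𝓘(ℝ, E) x) : J x (J x a) = -a := by
  change Complex.I • Complex.I • (show E from a) = -(show E from a)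
  rw [smul_smul, Complex.I_mul_I, neg_one_smul]

namespace ComplexContactMetricStructure

variable [IsManifold 𝓘(ℂ, E) ω M] {n : ℕ} {ι : Type*} (C : ComplexContactMetricStructure E M n ι)

theorem contactAlgebra {i : ι} {x : M} (hx : x ∈ C.O i) :
    ContactAlgebra (E := E) (C.g.val x) (C.u i x) (C.v i x) (C.U i x) (C.V i x) (C.G i x)
      (C.H i x) := by
  have gJ : ∀ a b, C.g.val x (J x a) b = -C.g.val x a (J x b) := fun a b => by
    rw [← C.hermitian x (J x a) b, J_J, map_neg, neg_apply]
  have gV : ∀ a, C.g.val x (C.V i x) a = C.v i x a := fun a => by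
    rw [C.V_eq i x hx, map_neg, neg_apply, gJ, neg_neg, C.U_dual i x hx,
      C.v_eq i x hx]
  have vU : C.v i x (C.U i x) = 0 := by
    have h1 := gJ (C.U i x) (C.U i x)
    rw [C.g.symm, C.U_dual i x hx, ← C.v_eq i x hx] at h1
    linarith
  have uV : C.u i x (C.V i x) = 0 := by
    rw [← C.U_dual i x hx, C.g.symm, gV, vU]
  have GV : C.G i x (C.V i x) = 0 := by
    rw [C.V_eq i x hx, map_neg, C.G_J i x hx, C.G_U i x hx, map_zero, neg_zero, neg_zero]
  have JV : J x (C.V i x) = C.U i x := by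
    rw [C.V_eq i x hx, map_neg, J_J, neg_neg]
  have JU : J x (C.U i x) = -C.V i x := by
    rw [C.V_eq i x hx, neg_neg]
  have vV : C.v i x (C.V i x) = 1 := by rw [C.v_eq i x hx, JV, C.u_U i x hx]
  have HU : C.H i x (C.U i x) = 0 := by rw [C.H_eq i x hx, JU, map_neg, GV, neg_zero]
  have HV : C.H i x (C.V i x) = 0 := by rw [C.H_eq i x hx, JV, C.G_U i x hx]
  have GH : ∀ a, C.G i x (C.H i x a) = -C.H i x (C.G i x a) := fun a => by
    rw [C.H_eq i x hx, C.H_eq i x hx, ← map_neg, ← C.G_J i x hx]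
  have H_skew : ∀ a b, C.g.val x (C.H i x a) b = -C.g.val x a (C.H i x b) := fun a b => by
    rw [C.H_eq i x hx, C.H_eq i x hx, C.G_skew i x hx, gJ, neg_neg, C.G_J i x hx b, map_neg,
      neg_neg]
  exact ⟨C.g.symm x, C.U_dual i x hx, gV, C.u_U i x hx, vV, uV, vU, C.G_U i x hx, GV, HU, HV,
    C.G_sq i x hx, C.H_sq i x hx, GH, C.G_skew i x hx, H_skew⟩

end ComplexContactMetricStructure
end Structure

section ChartTensors

/-- The value at a point of the tensor field `S`, in terms of the Nijenhuis term `N` and the values of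
the structure tensors. -/
def tensorSExpr {E : Type*} [AddCommGroup E] [Module ℝ E] (N a b : E) (g : E → E → ℝ) (v σ : E → ℝ)
    (U V : E) (G H : E → E) : E :=
  N + (2 * g a (G b)) • U - (2 * g a (H b)) • V + (2 : ℝ) • (v b • H a - v a • H b)
    + σ (G b) • H a - σ (G a) • H b + σ a • G (H b) - σ b • G (H a)

/-- The value at a point of the tensor field `T`, in terms of the Nijenhuis term `N` and the values of
the structure tensors. -/
def tensorTExpr {E : Type*} [AddCommGroup E] [Module ℝ E] (N a b : E) (g : E → E → ℝ) (u σ : E → ℝ)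
    (U V : E) (G H : E → E) : E :=
  N - (2 * g a (G b)) • U + (2 * g a (H b)) • V + (2 : ℝ) • (u b • G a - u a • G b)
    + σ (H a) • G b - σ (H b) • G a + σ a • G (H b) - σ b • G (H a)

variable {E : Type*} [NormedAddCommGroup E] [NormedSpace ℂ E]
  {M : Type*} [TopologicalSpace M] [ChartedSpace E M] [IsManifold 𝓘(ℂ, E) ω M]

theorem VField.SmoothOn.mono {X : VField ℝ E M} {O W : Set M} {k : ℕ∞ω} (hX : X.SmoothOn k O)
    (h : W ⊆ O) : X.SmoothOn k W := ContMDiffOn.mono hX h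

theorem EndField.SmoothOn.mono {A : EndField ℝ E M} {O W : Set M} {k : ℕ∞ω} (hA : A.SmoothOn k O)
    (h : W ⊆ O) : A.SmoothOn k W := ContMDiffOn.mono hA h

theorem EndField.SmoothOn.apply {A : EndField ℝ E M} {X : VField ℝ E M} {O : Set M} {k : ℕ∞ω}
    (hA : A.SmoothOn k O) (hX : X.SmoothOn k O) : VField.SmoothOn k (fun y => A y (X y)) O :=
  ContMDiffOn.clm_bundle_apply hA hX

namespace ComplexContactMetricStructure

variable {n : ℕ} {ι : Type*} (C : ComplexContactMetricStructure E M n ι)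

theorem isHorizontalOn_iff {i : ι} {X : VField ℝ E M} {W : Set M} (hW : W ⊆ C.O i) :
    C.IsHorizontalOn i X W ↔ ∀ x ∈ W, C.u i x (X x) = 0 ∧ C.v i x (X x) = 0 := by
  obtain ⟨c, hc⟩ := C.contact_form i
  refine forall₂_congr fun x hx => ?_
  obtain ⟨hc0, hcX⟩ := hc x (hW hx)
  rw [hcX (X x), mul_eq_zero, or_iff_right hc0]
  have : (((show E →L[ℝ] ℝ from C.u i x) (X x) : ℂ)
      - Complex.I * (show E →L[ℝ] ℝ from C.v i x) (X x)) = ⟨C.u i x (X x), -C.v i x (X x)⟩ := by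
    apply Complex.ext <;> simp <;> rfl
  rw [this, Complex.ext_iff]
  simp

/-- Horizontal vectors extend to horizontal vector fields. -/
theorem exists_horizontal_extension {i : ι} {x₀ : M} (hx : x₀ ∈ C.O i) {a : E}
    (ua : C.u i x₀ a = 0) (va : C.v i x₀ a = 0) :
    ∃ X : VField ℝ E M, X.SmoothOn ∞ (C.O i ∩ (chartAt E x₀).source) ∧
      C.IsHorizontalOn i X (C.O i ∩ (chartAt E x₀).source) ∧ X x₀ = a := by
  have hG : (C.G i).SmoothOn ∞ (C.O i ∩ (chartAt E x₀).source) :=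
    (C.G_smooth i).mono inter_subset_left
  -- `-G²` is the projection to the horizontal subspace
  refine ⟨fun y => C.G i y (C.G i y (coordField x₀ (-a) y)),
    hG.apply (hG.apply ((smoothOn_coordField x₀ (-a)).mono inter_subset_right)),
    (C.isHorizontalOn_iff inter_subset_left).2 fun x hx =>
      ⟨(C.contactAlgebra hx.1).u_G _, (C.contactAlgebra hx.1).v_G _⟩, ?_⟩
  have e : coordField x₀ (-a) x₀ = -a := ofChart_self x₀ (-a)
  have := (C.contactAlgebra hx).G_sq_of_horizontal (a := -a)
    ((map_neg (C.u i x₀) a).trans (neg_eq_zero.2 ua))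
    ((map_neg (C.v i x₀) a).trans (neg_eq_zero.2 va))
  rw [neg_neg] at this
  exact (congrArg (fun w => C.G i x₀ (C.G i x₀ w)) e).trans this

/-- The tensor `S` at the centre of a chart. -/
theorem tensorS_chart {i : ι} {x₀ : M} {W : Set M} (hW : IsOpen W) (hWO : W ⊆ C.O i) (hx : x₀ ∈ W)
    {X Y : VField ℝ E M} (hX : X.SmoothOn ∞ W) (hY : Y.SmoothOn ∞ W) {a b : E} (ha : X x₀ = a)
    (hb : Y x₀ = b) {g : E → E →L[ℝ] E →L[ℝ] ℝ} (hg : chartMetric x₀ C.g = g)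
    {v σ : E → E →L[ℝ] ℝ} (hv : chartForm x₀ (C.v i) = v)
    (hσ : chartForm x₀ (C.σ i) = σ) {U V : E → E} (hU : chartVec x₀ (C.U i) = U)
    (hV : chartVec x₀ (C.V i) = V) {G H : E → E →L[ℝ] E} (hG : chartEnd x₀ (C.G i) = G)
    (hH : chartEnd x₀ (C.H i) = H) {z : E} (hz : extChartAt 𝓘(ℝ, E) x₀ x₀ = z) :
    @Eq E (C.tensorS i X Y x₀)
      (fderiv ℝ G z (G z a) b - fderiv ℝ G z (G z b) a + G z (fderiv ℝ G z b a)
        - G z (fderiv ℝ G z a b)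
        + (2 * g z a (G z b)) • U z - (2 * g z a (H z b)) • V z
        + (2 : ℝ) • (v z b • H z a - v z a • H z b)
        + σ z (G z b) • H z a - σ z (G z a) • H z b
        + σ z a • G z (H z b) - σ z b • G z (H z a)) := by
  have hn : @Eq E (nijenhuis (C.G i) X Y x₀) _ :=
    nijenhuis_self ((C.G_smooth i).mono hWO) hX hY hW hx ha hb hG hz
  subst hg hv hσ hU hV hG hH hz
  have eg : (fun p q : E => C.g.val x₀ p q)
      = fun p q => chartMetric x₀ C.g (extChartAt 𝓘(ℝ, E) x₀ x₀) p q :=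
    funext₂ fun p q => (chartMetric_self x₀ C.g p q).symm
  have ev : (fun p : E => C.v i x₀ p)
      = fun p => chartForm x₀ (C.v i) (extChartAt 𝓘(ℝ, E) x₀ x₀) p :=
    funext fun p => (chartForm_self x₀ _ p).symm
  have eσ : (fun p : E => C.σ i x₀ p)
      = fun p => chartForm x₀ (C.σ i) (extChartAt 𝓘(ℝ, E) x₀ x₀) p :=
    funext fun p => (chartForm_self x₀ _ p).symm
  have eG : @Eq (E → E) (fun p => C.G i x₀ p)
      fun p => chartEnd x₀ (C.G i) (extChartAt 𝓘(ℝ, E) x₀ x₀) p :=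
    funext fun p => (chartEnd_self x₀ _ p).symm
  have eH : @Eq (E → E) (fun p => C.H i x₀ p)
      fun p => chartEnd x₀ (C.H i) (extChartAt 𝓘(ℝ, E) x₀ x₀) p :=
    funext fun p => (chartEnd_self x₀ _ p).symm
  have eU : @Eq E (C.U i x₀) (chartVec x₀ (C.U i) (extChartAt 𝓘(ℝ, E) x₀ x₀)) :=
    (chartVec_self x₀ _).symm
  have eV : @Eq E (C.V i x₀) (chartVec x₀ (C.V i) (extChartAt 𝓘(ℝ, E) x₀ x₀)) :=
    (chartVec_self x₀ _).symm
  have ht : C.tensorS i X Y x₀ = tensorSExpr (nijenhuis (C.G i) X Y x₀) (X x₀) (Y x₀)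
      (fun p q => C.g.val x₀ p q) (fun p => C.v i x₀ p) (fun p => C.σ i x₀ p) (C.U i x₀)
      (C.V i x₀) (fun p => C.G i x₀ p) (fun p => C.H i x₀ p) := rfl
  have ht' : @Eq E (C.tensorS i X Y x₀) (@tensorSExpr E _ _ (nijenhuis (C.G i) X Y x₀) (X x₀)
      (Y x₀) (fun p q => C.g.val x₀ p q) (fun p => C.v i x₀ p) (fun p => C.σ i x₀ p) (C.U i x₀)
      (C.V i x₀) (fun p => C.G i x₀ p) (fun p => C.H i x₀ p)) := ht
  rw [hn, ha, hb, eg, ev, eσ, eU, eV, eG, eH] at ht'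
  exact ht'

/-- The tensor `T` at the centre of a chart. -/
theorem tensorT_chart {i : ι} {x₀ : M} {W : Set M} (hW : IsOpen W) (hWO : W ⊆ C.O i) (hx : x₀ ∈ W)
    {X Y : VField ℝ E M} (hX : X.SmoothOn ∞ W) (hY : Y.SmoothOn ∞ W) {a b : E} (ha : X x₀ = a)
    (hb : Y x₀ = b) {g : E → E →L[ℝ] E →L[ℝ] ℝ} (hg : chartMetric x₀ C.g = g)
    {u σ : E → E →L[ℝ] ℝ} (hu : chartForm x₀ (C.u i) = u)
    (hσ : chartForm x₀ (C.σ i) = σ) {U V : E → E} (hU : chartVec x₀ (C.U i) = U)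
    (hV : chartVec x₀ (C.V i) = V) {G H : E → E →L[ℝ] E} (hG : chartEnd x₀ (C.G i) = G)
    (hH : chartEnd x₀ (C.H i) = H) {z : E} (hz : extChartAt 𝓘(ℝ, E) x₀ x₀ = z) :
    @Eq E (C.tensorT i X Y x₀)
      (fderiv ℝ H z (H z a) b - fderiv ℝ H z (H z b) a + H z (fderiv ℝ H z b a)
        - H z (fderiv ℝ H z a b)
        - (2 * g z a (G z b)) • U z + (2 * g z a (H z b)) • V z
        + (2 : ℝ) • (u z b • G z a - u z a • G z b)
        + σ z (H z a) • G z b - σ z (H z b) • G z a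
        + σ z a • G z (H z b) - σ z b • G z (H z a)) := by
  have hn : @Eq E (nijenhuis (C.H i) X Y x₀) _ :=
    nijenhuis_self ((C.H_smooth i).mono hWO) hX hY hW hx ha hb hH hz
  subst hg hu hσ hU hV hG hH hz
  have eg : (fun p q : E => C.g.val x₀ p q)
      = fun p q => chartMetric x₀ C.g (extChartAt 𝓘(ℝ, E) x₀ x₀) p q :=
    funext₂ fun p q => (chartMetric_self x₀ C.g p q).symm
  have eu : (fun p : E => C.u i x₀ p)
      = fun p => chartForm x₀ (C.u i) (extChartAt 𝓘(ℝ, E) x₀ x₀) p :=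
    funext fun p => (chartForm_self x₀ _ p).symm
  have eσ : (fun p : E => C.σ i x₀ p)
      = fun p => chartForm x₀ (C.σ i) (extChartAt 𝓘(ℝ, E) x₀ x₀) p :=
    funext fun p => (chartForm_self x₀ _ p).symm
  have eG : @Eq (E → E) (fun p => C.G i x₀ p)
      fun p => chartEnd x₀ (C.G i) (extChartAt 𝓘(ℝ, E) x₀ x₀) p :=
    funext fun p => (chartEnd_self x₀ _ p).symm
  have eH : @Eq (E → E) (fun p => C.H i x₀ p)
      fun p => chartEnd x₀ (C.H i) (extChartAt 𝓘(ℝ, E) x₀ x₀) p :=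
    funext fun p => (chartEnd_self x₀ _ p).symm
  have eU : @Eq E (C.U i x₀) (chartVec x₀ (C.U i) (extChartAt 𝓘(ℝ, E) x₀ x₀)) :=
    (chartVec_self x₀ _).symm
  have eV : @Eq E (C.V i x₀) (chartVec x₀ (C.V i) (extChartAt 𝓘(ℝ, E) x₀ x₀)) :=
    (chartVec_self x₀ _).symm
  have ht : C.tensorT i X Y x₀ = tensorTExpr (nijenhuis (C.H i) X Y x₀) (X x₀) (Y x₀)
      (fun p q => C.g.val x₀ p q) (fun p => C.u i x₀ p) (fun p => C.σ i x₀ p) (C.U i x₀)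
      (C.V i x₀) (fun p => C.G i x₀ p) (fun p => C.H i x₀ p) := rfl
  have ht' : @Eq E (C.tensorT i X Y x₀) (@tensorTExpr E _ _ (nijenhuis (C.H i) X Y x₀) (X x₀)
      (Y x₀) (fun p q => C.g.val x₀ p q) (fun p => C.u i x₀ p) (fun p => C.σ i x₀ p) (C.U i x₀)
      (C.V i x₀) (fun p => C.G i x₀ p) (fun p => C.H i x₀ p)) := ht
  rw [hn, ha, hb, eg, eu, eσ, eU, eV, eG, eH] at ht'
  exact ht'

theorem eventually_contactAlgebra {i : ι} {x₀ : M} (hx : x₀ ∈ C.O i) :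
    ∀ᶠ z in 𝓝 (extChartAt 𝓘(ℝ, E) x₀ x₀), ContactAlgebra (chartMetric x₀ C.g z)
      (chartForm x₀ (C.u i) z) (chartForm x₀ (C.v i) z) (chartVec x₀ (C.U i) z)
      (chartVec x₀ (C.V i) z) (chartEnd x₀ (C.G i) z) (chartEnd x₀ (C.H i) z) := by
  filter_upwards [eventually_chart_source x₀, eventually_mem_of_isOpen (C.isOpen i) hx]
    with z hz hz'
  exact (C.contactAlgebra hz').conj (ofChart_toChart hz) (toChart_ofChart hz)

/-- The structure equation for `du` in a chart.  The factor `2` comes from the normalisation of the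
exterior derivative. -/
theorem eventually_du [FiniteDimensional ℂ E] {i : ι} {x₀ : M} (hx : x₀ ∈ C.O i) :
    ∀ᶠ z in 𝓝 (extChartAt 𝓘(ℝ, E) x₀ x₀), ∀ a b,
      fderiv ℝ (chartForm x₀ (C.u i)) z a b - fderiv ℝ (chartForm x₀ (C.u i)) z b a
      = 2 * chartMetric x₀ C.g z a (chartEnd x₀ (C.G i) z b)
        + chartForm x₀ (C.σ i) z a * chartForm x₀ (C.v i) z b
        - chartForm x₀ (C.σ i) z b * chartForm x₀ (C.v i) z a := by
  have : CompleteSpace E := FiniteDimensional.complete ℂ E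
  filter_upwards [eventually_chart_source x₀, eventually_mem_of_isOpen (C.isOpen i) hx,
    extDer_coordField (C.u_smooth i) (C.isOpen i) hx] with z hz hz' hd a b
  have h := C.du_eq i (C.O i ∩ (chartAt E x₀).source)
    ((C.isOpen i).inter (chartAt E x₀).open_source) inter_subset_left (coordField x₀ a)
    (coordField x₀ b) ((smoothOn_coordField x₀ a).mono inter_subset_right)
    ((smoothOn_coordField x₀ b).mono inter_subset_right) _ ⟨hz', hz⟩
  rw [hd a b, wedge] at h
  have e : chartMetric x₀ C.g z a (chartEnd x₀ (C.G i) z b)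
      = C.g.val _ (coordField x₀ a ((extChartAt 𝓘(ℝ, E) x₀).symm z))
        (C.G i _ (coordField x₀ b ((extChartAt 𝓘(ℝ, E) x₀).symm z))) :=
    congrArg (fun w => C.g.val _ (coordField x₀ a _) w) (ofChart_toChart hz _)
  rw [e]
  change _ = 2 * _ + C.σ i _ (coordField x₀ a _) * C.v i _ (coordField x₀ b _)
    - C.σ i _ (coordField x₀ b _) * C.v i _ (coordField x₀ a _)
  linarith

theorem eventually_dv [FiniteDimensional ℂ E] {i : ι} {x₀ : M} (hx : x₀ ∈ C.O i) :
    ∀ᶠ z in 𝓝 (extChartAt 𝓘(ℝ, E) x₀ x₀), ∀ a b,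
      fderiv ℝ (chartForm x₀ (C.v i)) z a b - fderiv ℝ (chartForm x₀ (C.v i)) z b a
      = 2 * chartMetric x₀ C.g z a (chartEnd x₀ (C.H i) z b)
        - (chartForm x₀ (C.σ i) z a * chartForm x₀ (C.u i) z b
          - chartForm x₀ (C.σ i) z b * chartForm x₀ (C.u i) z a) := by
  have : CompleteSpace E := FiniteDimensional.complete ℂ E
  filter_upwards [eventually_chart_source x₀, eventually_mem_of_isOpen (C.isOpen i) hx,
    extDer_coordField (C.v_smooth i) (C.isOpen i) hx] with z hz hz' hd a b
  have h := C.dv_eq i (C.O i ∩ (chartAt E x₀).source)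
    ((C.isOpen i).inter (chartAt E x₀).open_source) inter_subset_left (coordField x₀ a)
    (coordField x₀ b) ((smoothOn_coordField x₀ a).mono inter_subset_right)
    ((smoothOn_coordField x₀ b).mono inter_subset_right) _ ⟨hz', hz⟩
  rw [hd a b, wedge] at h
  have e : chartMetric x₀ C.g z a (chartEnd x₀ (C.H i) z b)
      = C.g.val _ (coordField x₀ a ((extChartAt 𝓘(ℝ, E) x₀).symm z))
        (C.H i _ (coordField x₀ b ((extChartAt 𝓘(ℝ, E) x₀).symm z))) :=
    congrArg (fun w => C.g.val _ (coordField x₀ a _) w) (ofChart_toChart hz _)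
  rw [e]
  change _ = 2 * _ - (C.σ i _ (coordField x₀ a _) * C.u i _ (coordField x₀ b _)
    - C.σ i _ (coordField x₀ b _) * C.u i _ (coordField x₀ a _))
  linarith

end ComplexContactMetricStructure
end ChartTensors

section Rotation

variable {E : Type*} [NormedAddCommGroup E] [NormedSpace ℝ E]
  {g : E → E →L[ℝ] E →L[ℝ] ℝ} {u v σ : E → E →L[ℝ] ℝ} {U V : E → E} {G H : E → E →L[ℝ] E} {z : E}

/-- The quarter turn of a normal jet is a normal jet, provided that the tensor `T` vanishes as it
should: the tensor `S` of the rotated structure is `T`. -/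
theorem NormalJet.rotate (h : NormalJet g u v σ U V G H z)
    (hT : ∀ a b, u z a = 0 → v z a = 0 → u z b = 0 → v z b = 0 →
      fderiv ℝ H z (H z a) b - fderiv ℝ H z (H z b) a + H z (fderiv ℝ H z b a)
        - H z (fderiv ℝ H z a b)
        - (2 * g z a (G z b)) • U z + (2 * g z a (H z b)) • V z
        + σ z (H z a) • G z b - σ z (H z b) • G z a
        + σ z a • G z (H z b) - σ z b • G z (H z a) = 0)
    (hTV : ∀ b, H z (fderiv ℝ H z b (V z)) - fderiv ℝ H z (H z b) (V z)
      - H z (fderiv ℝ H z (V z) b) + σ z (V z) • G z (H z b) = 0) :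
    NormalJet g (fun y => -v y) u σ (fun y => -V y) U (fun y => -H y) G z where
  diff_g := h.diff_g
  contDiff_u := h.contDiff_v.neg
  contDiff_v := h.contDiff_u
  diff_σ := h.diff_σ
  diff_U := h.diff_V.neg
  diff_V := h.diff_U
  diff_G := h.diff_H.neg
  diff_H := h.diff_G
  algebra := h.algebra.mono fun y hy => hy.rotate
  du := h.dv.mono fun y hy a b => by
    have h1 : g y a (-H y b) = -g y a (H y b) := map_neg (g y a) _
    have h2 (a b : E) : fderiv ℝ (fun y => -v y) y a b = -fderiv ℝ v y a b := by
      rw [fderiv_fun_neg]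
      rfl
    rw [h2, h2, neg_apply (H y), h1]
    linarith [hy a b]
  dv := h.du.mono fun y hy a b => by
    rw [neg_apply (v y), neg_apply (v y)]
    linarith [hy a b]
  tensorS a b va ua vb ub := by
    have va' : v z a = 0 := neg_eq_zero.1 va
    have vb' : v z b = 0 := neg_eq_zero.1 vb
    have hz := h.algebra.self_of_nhds
    have key := hT a b ua va' ub vb'
    have h1 : g z a (-H z b) = -g z a (H z b) := map_neg (g z a) _
    have h2 (w : E) : fderiv ℝ H z (-w) = -fderiv ℝ H z w := map_neg (fderiv ℝ H z) _
    have h3 (w : E) : H z (-w) = -H z w := map_neg (H z) _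
    have h4 (w : E) : σ z (-w) = -σ z w := map_neg (σ z) _
    have h5 (w : E) : H z (G z w) = -G z (H z w) := by rw [hz.GH, neg_neg]
    rw [fderiv_fun_neg]
    simp only [neg_apply (H z), neg_apply (fderiv ℝ H z), h1, h2, h3, h4, h5, neg_apply, neg_neg]
    rw [← key]
    module
  tensorS_U b := by
    have hz := h.algebra.self_of_nhds
    have key := hTV b
    have h2 (w : E) : fderiv ℝ H z (-w) = -fderiv ℝ H z w := map_neg (fderiv ℝ H z) _
    have h4 (w : E) : σ z (-w) = -σ z w := map_neg (σ z) _
    have h5 (w : E) : H z (G z w) = -G z (H z w) := by rw [hz.GH, neg_neg]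
    have h6 (a w : E) : fderiv ℝ H z a (-w) = -fderiv ℝ H z a w := map_neg (fderiv ℝ H z a) _
    rw [fderiv_fun_neg]
    simp only [neg_apply (H z), neg_apply (fderiv ℝ H z), h2, h4, h5, h6, neg_apply, neg_neg]
    rw [← neg_eq_zero, ← key]
    module

end Rotation

section Jet

variable {E : Type*} [NormedAddCommGroup E] [NormedSpace ℂ E] [FiniteDimensional ℂ E]
  {M : Type*} [TopologicalSpace M] [ChartedSpace E M] [IsManifold 𝓘(ℂ, E) ω M]

namespace ComplexContactMetricStructure

variable {n : ℕ} {ι : Type*} {C : ComplexContactMetricStructure E M n ι}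

/-- In a chart, a normal complex contact metric structure is a normal jet at the centre. -/
theorem IsNormal.normalJet (hC : C.IsNormal) {i : ι} {x₀ : M} (hx : x₀ ∈ C.O i) :
    NormalJet (chartMetric x₀ C.g) (chartForm x₀ (C.u i)) (chartForm x₀ (C.v i))
      (chartForm x₀ (C.σ i)) (chartVec x₀ (C.U i)) (chartVec x₀ (C.V i)) (chartEnd x₀ (C.G i))
      (chartEnd x₀ (C.H i)) (extChartAt 𝓘(ℝ, E) x₀ x₀) where
  diff_g := (C.g.contDiffAt_chartMetric x₀).differentiableAt (by simp)
  contDiff_u := ((C.u_smooth i).contDiffAt_chartForm (C.isOpen i) hx).of_le ENat.LEInfty.out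
  contDiff_v := ((C.v_smooth i).contDiffAt_chartForm (C.isOpen i) hx).of_le ENat.LEInfty.out
  diff_σ := ((C.σ_smooth i).contDiffAt_chartForm (C.isOpen i) hx).differentiableAt (by simp)
  diff_U := ((C.U_smooth i).contDiffAt_chartVec (C.isOpen i) hx).differentiableAt (by simp)
  diff_V := ((C.V_smooth i).contDiffAt_chartVec (C.isOpen i) hx).differentiableAt (by simp)
  diff_G := ((C.G_smooth i).contDiffAt_chartEnd (C.isOpen i) hx).differentiableAt (by simp)
  diff_H := ((C.H_smooth i).contDiffAt_chartEnd (C.isOpen i) hx).differentiableAt (by simp)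
  algebra := C.eventually_contactAlgebra hx
  du := C.eventually_du hx
  dv := C.eventually_dv hx
  tensorS a b ua va ub vb := by
    have hW := (C.isOpen i).inter (chartAt E x₀).open_source
    have hxW : x₀ ∈ C.O i ∩ (chartAt E x₀).source := ⟨hx, mem_chart_source E x₀⟩
    obtain ⟨X, hX, hX', hXa⟩ := C.exists_horizontal_extension hx
      ((chartForm_self x₀ _ a).symm.trans ua) ((chartForm_self x₀ _ a).symm.trans va)
    obtain ⟨Y, hY, hY', hYb⟩ := C.exists_horizontal_extension hx
      ((chartForm_self x₀ _ b).symm.trans ub) ((chartForm_self x₀ _ b).symm.trans vb)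
    have h1 := ((hC i _ hW inter_subset_left).1 X Y hX hY hX' hY' x₀ hxW).1
    have h2 := C.tensorS_chart hW inter_subset_left hxW hX hY hXa hYb rfl rfl rfl rfl rfl rfl rfl rfl
    have h3 := h2.symm.trans h1
    rw [va, vb, zero_smul, zero_smul, sub_zero, smul_zero, add_zero] at h3
    exact h3
  tensorS_U b := by
    have hW := (C.isOpen i).inter (chartAt E x₀).open_source
    have hxW : x₀ ∈ C.O i ∩ (chartAt E x₀).source := ⟨hx, mem_chart_source E x₀⟩
    have hU := (C.U_smooth i).mono (W := C.O i ∩ (chartAt E x₀).source) inter_subset_left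
    have hb := (smoothOn_coordField x₀ b).mono (k := ∞)
      (W := C.O i ∩ (chartAt E x₀).source) inter_subset_right
    have h1 := ((hC i _ hW inter_subset_left).2 _ hb x₀ hxW).1
    have h2 := C.tensorS_chart hW inter_subset_left hxW hU hb (chartVec_self (E := E) x₀ _).symm
      (ofChart_self x₀ b) rfl rfl rfl rfl rfl rfl rfl rfl
    have h3 := h2.symm.trans h1
    have hA := (C.eventually_contactAlgebra hx).self_of_nhds
    rw [hA.GU, hA.HU, hA.gU, hA.gU, hA.vU, hA.u_G, hA.u_H] at h3
    refine Eq.trans ?_ h3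
    simp only [map_zero, zero_apply]
    module

/-- The turned structure of a normal complex contact metric structure is a normal jet as well. -/
theorem IsNormal.normalJet_rotate (hC : C.IsNormal) {i : ι} {x₀ : M} (hx : x₀ ∈ C.O i) :
    NormalJet (chartMetric x₀ C.g) (fun y => -chartForm x₀ (C.v i) y) (chartForm x₀ (C.u i))
      (chartForm x₀ (C.σ i)) (fun y => -chartVec x₀ (C.V i) y) (chartVec x₀ (C.U i))
      (fun y => -chartEnd x₀ (C.H i) y) (chartEnd x₀ (C.G i)) (extChartAt 𝓘(ℝ, E) x₀ x₀) := by
  refine (hC.normalJet hx).rotate (fun a b ua va ub vb => ?_) fun b => ?_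
  · have hW := (C.isOpen i).inter (chartAt E x₀).open_source
    have hxW : x₀ ∈ C.O i ∩ (chartAt E x₀).source := ⟨hx, mem_chart_source E x₀⟩
    obtain ⟨X, hX, hX', hXa⟩ := C.exists_horizontal_extension hx
      ((chartForm_self x₀ _ a).symm.trans ua) ((chartForm_self x₀ _ a).symm.trans va)
    obtain ⟨Y, hY, hY', hYb⟩ := C.exists_horizontal_extension hx
      ((chartForm_self x₀ _ b).symm.trans ub) ((chartForm_self x₀ _ b).symm.trans vb)
    have h1 := ((hC i _ hW inter_subset_left).1 X Y hX hY hX' hY' x₀ hxW).2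
    have h2 := C.tensorT_chart hW inter_subset_left hxW hX hY hXa hYb rfl rfl rfl rfl rfl rfl rfl rfl
    have h3 := h2.symm.trans h1
    rw [ua, ub, zero_smul, zero_smul, sub_zero, smul_zero, add_zero] at h3
    exact h3
  · have hW := (C.isOpen i).inter (chartAt E x₀).open_source
    have hxW : x₀ ∈ C.O i ∩ (chartAt E x₀).source := ⟨hx, mem_chart_source E x₀⟩
    have hV := (C.V_smooth i).mono (W := C.O i ∩ (chartAt E x₀).source) inter_subset_left
    have hb := (smoothOn_coordField x₀ b).mono (k := ∞)
      (W := C.O i ∩ (chartAt E x₀).source) inter_subset_right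
    have h1 := ((hC i _ hW inter_subset_left).2 _ hb x₀ hxW).2
    have h2 := C.tensorT_chart hW inter_subset_left hxW hV hb (chartVec_self (E := E) x₀ _).symm
      (ofChart_self x₀ b) rfl rfl rfl rfl rfl rfl rfl rfl
    have h3 := h2.symm.trans h1
    have hA := (C.eventually_contactAlgebra hx).self_of_nhds
    rw [hA.GV, hA.HV, hA.gV, hA.gV, hA.uV, hA.v_G, hA.v_H] at h3
    refine Eq.trans ?_ h3
    simp only [map_zero, zero_apply]
    module

end ComplexContactMetricStructure
end Jet

/-! ### The Levi-Civita connection and immersions in charts -/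

section LeviCivita

variable {E : Type*} [NormedAddCommGroup E] [NormedSpace ℝ E]
  {M : Type*} [TopologicalSpace M] [ChartedSpace E M] [IsManifold 𝓘(ℝ, E) ω M]

/-- The Christoffel symbols of the first kind, as a linear form in the last argument. -/
def christoffelLinear (g : E → E →L[ℝ] E →L[ℝ] ℝ) (z a b : E) : E →ₗ[ℝ] ℝ where
  toFun c := christoffelForm g z a b c
  map_add' c d := by
    have h1 := map_add (fderiv ℝ g z a b) c d
    have h2 := map_add (fderiv ℝ g z b a) c d
    have h3 : fderiv ℝ g z (c + d) a b = fderiv ℝ g z c a b + fderiv ℝ g z d a b := by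
      exact congrArg (fun B : E →L[ℝ] E →L[ℝ] ℝ => B a b) ((fderiv ℝ g z).map_add c d)
    rw [christoffelForm, christoffelForm, christoffelForm, h1, h2, h3]
    ring
  map_smul' t c := by
    have h1 := map_smul (fderiv ℝ g z a b) t c
    have h2 := map_smul (fderiv ℝ g z b a) t c
    have h3 : fderiv ℝ g z (t • c) a b = t • fderiv ℝ g z c a b := by
      exact congrArg (fun B : E →L[ℝ] E →L[ℝ] ℝ => B a b) ((fderiv ℝ g z).map_smul t c)
    simp only [christoffelForm, h1, h2, h3, smul_eq_mul, RingHom.id_apply]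
    ring

theorem extend_eq_ofChart {x₀ y : M} (hy : y ∈ (chartAt E x₀).source)
    (b : TangentSpace 𝓘(ℝ, E) x₀) : FiberBundle.extend E b y = ofChart E x₀ y b := by
  have h1 : (trivializationAt E (TangentSpace 𝓘(ℝ, E)) x₀ ⟨x₀, b⟩).2 = b := by
    rw [← Trivialization.continuousLinearMapAt_apply_of_mem ℝ _
      (mem_baseSet_tangent (mem_chart_source E x₀))]
    exact toChart_self x₀ b
  rw [FiberBundle.extend, h1]
  exact ((trivializationAt E (TangentSpace 𝓘(ℝ, E)) x₀).symmL_apply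
    (mem_baseSet_tangent hy) b).symm

namespace SemiRiemannianMetric

variable (g : SemiRiemannianMetric E M)

theorem derivComponent_eq (x : M) (a b c : TangentSpace 𝓘(ℝ, E) x) :
    g.derivComponent x a b c
      = fderiv ℝ (chartMetric x g) (extChartAt 𝓘(ℝ, E) x x) a b c := by
  have hg : DifferentiableAt ℝ (chartMetric x g) (extChartAt 𝓘(ℝ, E) x x) :=
    (g.contDiffAt_chartMetric x).differentiableAt (by simp)
  have he : (fun y => g.val y (FiberBundle.extend E b y) (FiberBundle.extend E c y))
      ∘ (extChartAt 𝓘(ℝ, E) x).symm =ᶠ[𝓝 (extChartAt 𝓘(ℝ, E) x x)]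
      fun z => chartMetric x g z b c := by
    filter_upwards [eventually_chart_source x] with z hz
    simp only [Function.comp_apply]
    rw [extend_eq_ofChart hz, extend_eq_ofChart hz]
    rfl
  have hd : DifferentiableAt ℝ (fun z => chartMetric x g z b c) (extChartAt 𝓘(ℝ, E) x x) :=
    (hg.clm_apply (differentiableAt_const b)).clm_apply (differentiableAt_const c)
  have h := mvfderiv_eq_fderiv_toChart (mem_chart_source E x) (he.symm.differentiableAt_iff.1 hd) a
  rw [toChart_self, he.fderiv_eq] at h
  refine h.trans ?_
  rw [fderiv_clm_apply_const (A := fun z => chartMetric x g z b)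
    (hg.clm_apply (differentiableAt_const b)) c a, fderiv_clm_apply_const hg b a]

/-- The Christoffel symbols are those of the chart at the point. -/
theorem val_christoffel [FiniteDimensional ℝ E] (x : M) (v w c : TangentSpace 𝓘(ℝ, E) x) :
    g.val x (g.christoffel x v w) c
      = christoffelForm (chartMetric x g) (extChartAt 𝓘(ℝ, E) x x) v w c := by
  have : FiniteDimensional ℝ (TangentSpace 𝓘(ℝ, E) x) := inferInstanceAs (FiniteDimensional ℝ E)
  let b := Module.finBasis ℝ (TangentSpace 𝓘(ℝ, E) x)
  let L : E →ₗ[ℝ] ℝ := christoffelLinear (chartMetric x g) (extChartAt 𝓘(ℝ, E) x x) v w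
  suffices h : g.bilin x (g.christoffel x v w) = (show TangentSpace 𝓘(ℝ, E) x →ₗ[ℝ] ℝ from L) from
    LinearMap.congr_fun h c
  refine b.ext fun k => ?_
  have h1 (j) : g.bilin x ((g.bilin x).dualBasis (g.bilin_nondegenerate x) b j) (b k)
      = if k = j then 1 else 0 := LinearMap.BilinForm.apply_dualBasis_left _ _ _ _
  rw [christoffel]
  simp only [map_sum, LinearMap.sum_apply, map_smul, LinearMap.smul_apply]
  refine (Finset.sum_congr rfl fun j _ => congrArg _ (h1 j)).trans ?_
  simp only [smul_eq_mul, mul_ite, mul_one, mul_zero, Finset.sum_ite_eq, Finset.mem_univ, if_true,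
    derivComponent_eq]
  rfl

end SemiRiemannianMetric

end LeviCivita

section Along

variable {E : Type*} [NormedAddCommGroup E] [NormedSpace ℝ E]
  {M : Type*} [TopologicalSpace M] [ChartedSpace E M]
  {P : Type*} [NormedAddCommGroup P] [NormedSpace ℝ P]
  {N : Type*} [TopologicalSpace N] [ChartedSpace P N]

variable (P E) in
/-- The map `f` in the preferred charts at `p` and `f p`. -/
def chartMap (f : N → M) (p : N) : P → E :=
  extChartAt 𝓘(ℝ, E) (f p) ∘ f ∘ (extChartAt 𝓘(ℝ, P) p).symm

theorem chartMap_self (f : N → M) (p : N) :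
    chartMap E P f p (extChartAt 𝓘(ℝ, P) p p) = extChartAt 𝓘(ℝ, E) (f p) (f p) := by
  simp [chartMap]

theorem contDiffAt_chartMap {f : N → M} (hf : ContMDiff 𝓘(ℝ, P) 𝓘(ℝ, E) ∞ f) (p : N) :
    ContDiffAt ℝ ∞ (chartMap E P f p) (extChartAt 𝓘(ℝ, P) p p) := by
  have h := (contMDiffAt_iff.1 (hf p)).2
  rw [← contDiffWithinAt_univ]
  simpa [chartMap] using h

variable [IsManifold 𝓘(ℝ, E) ω M]
  [IsManifold 𝓘(ℝ, P) 1 N]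

/-- Near the centre of the charts, the derivative of `chartMap` is the derivative of `f`, with tangent
vectors of both manifolds expressed in the charts. -/
theorem fderiv_chartMap {f : N → M} (hf : ContMDiff 𝓘(ℝ, P) 𝓘(ℝ, E) ∞ f) (p : N) : ∀ᶠ z in 𝓝 (extChartAt 𝓘(ℝ, P) p p),
    extChartAt 𝓘(ℝ, P) p ((extChartAt 𝓘(ℝ, P) p).symm z) = z ∧
    f ((extChartAt 𝓘(ℝ, P) p).symm z) ∈ (chartAt E (f p)).source ∧
    (∀ b, ∃ w, mfderiv 𝓘(ℝ, P) 𝓘(ℝ, P) (extChartAt 𝓘(ℝ, P) p)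
      ((extChartAt 𝓘(ℝ, P) p).symm z) w = b) ∧
    ∀ w, fderiv ℝ (chartMap E P f p) z (mfderiv 𝓘(ℝ, P) 𝓘(ℝ, P) (extChartAt 𝓘(ℝ, P) p)
      ((extChartAt 𝓘(ℝ, P) p).symm z) w)
      = toChart E (f p) (f ((extChartAt 𝓘(ℝ, P) p).symm z))
        (mfderiv 𝓘(ℝ, P) 𝓘(ℝ, E) f ((extChartAt 𝓘(ℝ, P) p).symm z) w) := by
  have hc : ContinuousAt (fun z => f ((extChartAt 𝓘(ℝ, P) p).symm z)) (extChartAt 𝓘(ℝ, P) p p) :=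
    hf.continuous.continuousAt.comp (continuousAt_extChartAt_symm p)
  have h1 : ∀ᶠ z in 𝓝 (extChartAt 𝓘(ℝ, P) p p),
      f ((extChartAt 𝓘(ℝ, P) p).symm z) ∈ (chartAt E (f p)).source := by
    refine hc.eventually ?_
    simp only [extChartAt_to_inv]
    exact (chartAt E (f p)).open_source.mem_nhds (mem_chart_source E _)
  have h2 : ∀ᶠ z in 𝓝 (extChartAt 𝓘(ℝ, P) p p), z ∈ (extChartAt 𝓘(ℝ, P) p).target :=
    extChartAt_target_mem_nhds p
  filter_upwards [h1, h2, ((contDiffAt_chartMap hf p).of_le (m := 1) ENat.LEInfty.out).eventually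
    (by simp)] with z hz hzt hd
  have hs := (extChartAt 𝓘(ℝ, P) p).map_target hzt
  have hr := (extChartAt 𝓘(ℝ, P) p).right_inv hzt
  refine ⟨hr, hz, (isInvertible_mfderiv_extChartAt hs).surjective, fun w => ?_⟩
  have h3 := mvfderiv_eq_fderiv_chart (h := extChartAt 𝓘(ℝ, E) (f p) ∘ f) (x₀ := p)
    (y := (extChartAt 𝓘(ℝ, P) p).symm z) (by rwa [extChartAt_source] at hs)
    (by rw [hr]; exact hd.differentiableAt (by simp)) w
  rw [hr] at h3
  refine h3.symm.trans ?_
  rw [toChart_eq_mfderiv hz]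
  have h4 := mfderiv_comp ((extChartAt 𝓘(ℝ, P) p).symm z)
    (mdifferentiableAt_extChartAt (I := 𝓘(ℝ, E)) hz) (hf.mdifferentiable (by simp) _)
  exact congrArg (fun L => L w) h4

end Along

section ChartValues

variable {E : Type*} [NormedAddCommGroup E] [NormedSpace ℝ E]
  {M : Type*} [TopologicalSpace M] [ChartedSpace E M] [IsManifold 𝓘(ℝ, E) ω M] {x₀ y : M}

theorem chartVec_extChartAt (hy : y ∈ (chartAt E x₀).source) (X : VField ℝ E M) :
    chartVec x₀ X (extChartAt 𝓘(ℝ, E) x₀ y) = toChart E x₀ y (X y) := by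
  rw [chartVec, (extChartAt 𝓘(ℝ, E) x₀).left_inv (by rwa [extChartAt_source])]

theorem chartEnd_extChartAt (hy : y ∈ (chartAt E x₀).source) (A : EndField ℝ E M)
    (w : TangentSpace 𝓘(ℝ, E) y) :
    chartEnd x₀ A (extChartAt 𝓘(ℝ, E) x₀ y) (toChart E x₀ y w) = toChart E x₀ y (A y w) := by
  rw [chartEnd, (extChartAt 𝓘(ℝ, E) x₀).left_inv (by rwa [extChartAt_source])]
  exact congrArg (fun v => toChart E x₀ y (A y v)) (ofChart_toChart hy w)

end ChartValues

section Along

variable {E : Type*} [NormedAddCommGroup E] [NormedSpace ℝ E]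
  {M : Type*} [TopologicalSpace M] [ChartedSpace E M] [IsManifold 𝓘(ℝ, E) ω M]
  {P : Type*} [NormedAddCommGroup P] [NormedSpace ℝ P]
  {N : Type*} [TopologicalSpace N] [ChartedSpace P N] [IsManifold 𝓘(ℝ, P) 1 N]
  {f : N → M}

theorem fderiv_chartMap_self (hf : ContMDiff 𝓘(ℝ, P) 𝓘(ℝ, E) ∞ f) (p : N) (v : P) :
    @Eq E (fderiv ℝ (chartMap E P f p) (extChartAt 𝓘(ℝ, P) p p) v)
      (mfderiv 𝓘(ℝ, P) 𝓘(ℝ, E) f p v) := by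
  have h := (fderiv_chartMap hf p).self_of_nhds.2.2.2
  rw [extChartAt_to_inv] at h
  have h' := h v
  rw [mfderiv_extChartAt_self, toChart_self] at h'
  exact h'

theorem eventually_injective_fderiv_chartMap (hf : ContMDiff 𝓘(ℝ, P) 𝓘(ℝ, E) ∞ f)
    (hinj : ∀ q, Function.Injective (mfderiv 𝓘(ℝ, P) 𝓘(ℝ, E) f q)) (p : N) :
    ∀ᶠ z in 𝓝 (extChartAt 𝓘(ℝ, P) p p), Function.Injective (fderiv ℝ (chartMap E P f p) z) := by
  filter_upwards [fderiv_chartMap hf p] with z ⟨_, hs, hsurj, hd⟩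
  refine (injective_iff_map_eq_zero (fderiv ℝ (chartMap E P f p) z)).2 fun b hb => ?_
  obtain ⟨w, rfl⟩ := hsurj b
  have h1 := congrArg (ofChart E (f p) (f ((extChartAt 𝓘(ℝ, P) p).symm z))) ((hd w).symm.trans hb)
  rw [ofChart_toChart hs, map_zero] at h1
  have h2 := hinj _ (h1.trans (map_zero _).symm)
  rw [h2]
  exact map_zero _

/-- A vector field of the ambient space that is tangent to the submanifold is tangent to it in
charts. -/
theorem eventually_chartVec_mem_range (hf : ContMDiff 𝓘(ℝ, P) 𝓘(ℝ, E) ∞ f) {p : N} {O : Set M}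
    (hO : IsOpen O) (hp : f p ∈ O) {X : VField ℝ E M}
    (hX : ∀ q, f q ∈ O → ∃ w, mfderiv 𝓘(ℝ, P) 𝓘(ℝ, E) f q w = X (f q)) :
    ∀ᶠ z in 𝓝 (extChartAt 𝓘(ℝ, P) p p), ∃ x, fderiv ℝ (chartMap E P f p) z x
      = chartVec (f p) X (chartMap E P f p z) := by
  have hOf : IsOpen (f ⁻¹' O) := hO.preimage hf.continuous
  filter_upwards [fderiv_chartMap hf p, eventually_mem_of_isOpen (E := P) hOf hp]
    with z ⟨_, hs, _, hd⟩ hz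
  obtain ⟨w, hw⟩ := hX _ hz
  exact ⟨_, (hd w).trans ((congrArg _ hw).trans (chartVec_extChartAt hs X).symm)⟩

/-- An endomorphism field of the ambient space that preserves the tangent spaces of the submanifold
preserves them in charts. -/
theorem eventually_chartEnd_mem_range (hf : ContMDiff 𝓘(ℝ, P) 𝓘(ℝ, E) ∞ f) {p : N} {O : Set M}
    (hO : IsOpen O) (hp : f p ∈ O) {A : EndField ℝ E M}
    (hA : ∀ q, f q ∈ O → ∀ v, ∃ w, mfderiv 𝓘(ℝ, P) 𝓘(ℝ, E) f q w
      = A (f q) (mfderiv 𝓘(ℝ, P) 𝓘(ℝ, E) f q v)) :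
    ∀ᶠ z in 𝓝 (extChartAt 𝓘(ℝ, P) p p), ∀ b, ∃ x, fderiv ℝ (chartMap E P f p) z x
      = chartEnd (f p) A (chartMap E P f p z) (fderiv ℝ (chartMap E P f p) z b) := by
  have hOf : IsOpen (f ⁻¹' O) := hO.preimage hf.continuous
  filter_upwards [fderiv_chartMap hf p, eventually_mem_of_isOpen (E := P) hOf hp]
    with z ⟨_, hs, hsurj, hd⟩ hz b
  obtain ⟨v, rfl⟩ := hsurj b
  obtain ⟨w, hw⟩ := hA _ hz v
  refine ⟨_, (hd w).trans ((congrArg _ hw).trans ?_)⟩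
  rw [hd v]
  exact (chartEnd_extChartAt hs A _).symm

end Along

section Submanifold

/-- A vector `a` that differs from `d` by a vector `t` with `B t w = 0` pairs with `w` like `d`. -/
theorem add_eq_zero_of_eq_sub {E : Type*} [NormedAddCommGroup E] [NormedSpace ℝ E]
    {B : E →L[ℝ] E →L[ℝ] ℝ} {a a' d t w : E} {c : ℝ} (ha : a' = a) (ht : t = a - d)
    (h : B t w = 0) (hd : B d w + c = 0) : B a' w + c = 0 := by
  have h1 : B a w = B d w + B t w := by
    rw [ht, map_sub B a d, sub_apply (B a), add_sub_cancel]
  rw [ha, h1, h, add_zero, hd]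

variable {E : Type*} [NormedAddCommGroup E] [NormedSpace ℝ E]
  {M : Type*} [TopologicalSpace M] [ChartedSpace E M] [IsManifold 𝓘(ℝ, E) ω M]
  {m : ℕ} {N : Type*} [TopologicalSpace N] [ChartedSpace (EuclideanSpace ℝ (Fin m)) N]
  [IsManifold (𝓡 m) 1 N] {f : N → M}

/-- The components, in the chart at `f p`, of a smooth vector field on the submanifold. -/
theorem contMDiffAt_components (hf : ContMDiff (𝓡 m) 𝓘(ℝ, E) ∞ f) {O : Set N} (hO : IsOpen O)
    {p : N} (hp : p ∈ O) {Y : Π p : N, TangentSpace (𝓡 m) p} (hY : VField.SmoothOn ∞ Y O) :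
    ContMDiffAt (𝓡 m) 𝓘(ℝ, E) 1 (fun q => (trivializationAt E (TangentSpace 𝓘(ℝ, E)) (f p)
      (⟨f q, mfderiv (𝓡 m) 𝓘(ℝ, E) f q (Y q)⟩ : TangentBundle 𝓘(ℝ, E) M)).2) p := by
  have h1 : ContMDiff (𝓡 m).tangent 𝓘(ℝ, E).tangent 1 (tangentMap (𝓡 m) 𝓘(ℝ, E) f) :=
    hf.contMDiff_tangentMap (by norm_cast)
  have h2 : ContMDiffAt (𝓡 m) (𝓡 m).tangent 1 (fun q => (⟨q, Y q⟩ : TangentBundle (𝓡 m) N)) p :=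
    (hY.contMDiffAt (hO.mem_nhds hp)).of_le ENat.LEInfty.out
  have h3 := h1.contMDiffAt.comp p h2
  exact ((Bundle.contMDiffAt_totalSpace).1 h3).2

/-- If in charts the second fundamental form of the submanifold vanishes in the normal direction `w`,
then `∇_X Y` is orthogonal to `w`. -/
theorem val_ambientCov_eq_zero [FiniteDimensional ℝ E] {g : SemiRiemannianMetric E M}
    (hf : ContMDiff (𝓡 m) 𝓘(ℝ, E) ∞ f)
    (hinj : ∀ q, Function.Injective (mfderiv (𝓡 m) 𝓘(ℝ, E) f q)) {O : Set N} (hO : IsOpen O)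
    {p : N} (hp : p ∈ O) (X : Π p : N, TangentSpace (𝓡 m) p) {Y : Π p : N, TangentSpace (𝓡 m) p}
    (hY : VField.SmoothOn ∞ Y O) {w : TangentSpace 𝓘(ℝ, E) (f p)} (hw : w ∈ normal m g f p)
    (hII : ∀ a b, chartMetric (f p) g (extChartAt 𝓘(ℝ, E) (f p) (f p))
        (fderiv ℝ (fderiv ℝ (chartMap E _ f p)) (extChartAt (𝓡 m) p p) a b) w
      + christoffelForm (chartMetric (f p) g) (extChartAt 𝓘(ℝ, E) (f p) (f p))
        (fderiv ℝ (chartMap E _ f p) (extChartAt (𝓡 m) p p) a)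
        (fderiv ℝ (chartMap E _ f p) (extChartAt (𝓡 m) p p) b) w = 0) :
    g.val (f p) (ScreenData.ambientCov g f X Y p) w = 0 := by
  let P := EuclideanSpace ℝ (Fin m)
  let Xp : P := X p
  let Yp : P := Y p
  let K : N → E := fun q => (trivializationAt E (TangentSpace 𝓘(ℝ, E)) (f p)
      (⟨f q, mfderiv (𝓡 m) 𝓘(ℝ, E) f q (Y q)⟩ : TangentBundle 𝓘(ℝ, E) M)).2
  have hK : ContMDiffAt (𝓡 m) 𝓘(ℝ, E) 1 K p := contMDiffAt_components hf hO hp hY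
  have hKd := (contDiffAt_comp_extChartAt_symm (E := P) hK).differentiableAt (by simp)
  have hFd := (contDiffAt_chartMap hf p).of_le (m := 2) ENat.LEInfty.out
  have hTd : DifferentiableAt ℝ (fderiv ℝ (chartMap E P f p)) (extChartAt 𝓘(ℝ, P) p p) :=
    (hFd.fderiv_right (m := 1) (by norm_num)).differentiableAt (by norm_num)
  have hd0 := fderiv_chartMap_self hf p
  have hKp {q : N} (hq : f q ∈ (chartAt E (f p)).source) :
      K q = toChart E (f p) (f q) (mfderiv (𝓡 m) 𝓘(ℝ, E) f q (Y q)) :=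
    (Trivialization.continuousLinearMapAt_apply_of_mem ℝ _ (mem_baseSet_tangent hq) _).symm
  have hKp0 : K p = mfderiv (𝓡 m) 𝓘(ℝ, E) f p (Y p) :=
    (hKp (mem_chart_source E (f p))).trans (toChart_self _ _)
  obtain ⟨x, hx⟩ := fderiv_sub_fderiv_mem_range (b := Yp) hTd hKd
    (eventually_injective_fderiv_chartMap hf hinj p).self_of_nhds (by
      filter_upwards [fderiv_chartMap hf p] with z ⟨_, hs, _, hd⟩
      exact ⟨_, (hd _).trans (hKp hs).symm⟩)
    ((hd0 _).trans (by rw [Function.comp_apply, extChartAt_to_inv]; exact hKp0.symm)) Xp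
  have hcov : @Eq E (mvfderiv (𝓡 m) K p Xp)
      (fderiv ℝ (K ∘ (extChartAt 𝓘(ℝ, P) p).symm) (extChartAt 𝓘(ℝ, P) p p) Xp) := by
    have h := mvfderiv_eq_fderiv_chart (E := P) (mem_chart_source P p) hKd Xp
    rw [mfderiv_extChartAt_self] at h
    exact h
  have hΓ := g.val_christoffel (f p) (mfderiv (𝓡 m) 𝓘(ℝ, E) f p (X p))
    (mfderiv (𝓡 m) 𝓘(ℝ, E) f p (Y p)) w
  have hII' := hII Xp Yp
  have hx' : g.val (f p) (mfderiv (𝓡 m) 𝓘(ℝ, E) f p x) w = 0 := hw _ ⟨x, rfl⟩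
  rw [hd0, hd0] at hII'
  have e1 : chartMetric (f p) g (extChartAt 𝓘(ℝ, E) (f p) (f p))
      (fderiv ℝ (chartMap E P f p) (extChartAt 𝓘(ℝ, P) p p) x) w = 0 :=
    (congrArg (fun v : E => chartMetric (f p) g (extChartAt 𝓘(ℝ, E) (f p) (f p)) v w)
      (hd0 x)).trans ((chartMetric_self _ g _ _).trans hx')
  have e2 : g.val (f p) (ScreenData.ambientCov g f X Y p) w
      = g.val (f p) (mvfderiv (𝓡 m) K p Xp : E) w
        + g.val (f p) (g.christoffel (f p) (mfderiv (𝓡 m) 𝓘(ℝ, E) f p (X p))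
          (mfderiv (𝓡 m) 𝓘(ℝ, E) f p (Y p))) w :=
    congrArg (fun L : TangentSpace 𝓘(ℝ, E) (f p) →L[ℝ] ℝ => L w) ((g.val (f p)).map_add _ _)
  have e3 := chartMetric_self (f p) g (mvfderiv (𝓡 m) K p Xp : E) w
  rw [e2, hΓ, ← e3]
  exact add_eq_zero_of_eq_sub hcov hx e1 hII'

end Submanifold

/-! ### Quaternion null submanifolds -/

section Geodesic

variable {E : Type*} [NormedAddCommGroup E] [NormedSpace ℂ E]
  {M : Type*} [TopologicalSpace M] [ChartedSpace E M] [IsManifold 𝓘(ℂ, E) ω M]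
  {n : ℕ} {ι : Type*} {C : ComplexContactMetricStructure E M n ι}
  {m r : ℕ} {N : Type*} [TopologicalSpace N] [ChartedSpace (EuclideanSpace ℝ (Fin m)) N]
  {f : N → M} {D : ScreenData m C.g f r}

namespace ComplexContactMetricStructure

/-- The tangent spaces of a quaternion null submanifold are invariant. -/
theorem IsQuaternionNull.tangent_invariant (h : C.IsQuaternionNull D) :
    C.IsInvariant f (tangent m f) := by
  intro p w hw
  rw [← D.screen_sup p] at hw
  obtain ⟨a, ha, b, hb, rfl⟩ := Submodule.mem_sup.1 hw
  obtain ⟨ha1, ha2⟩ := h.rad_invariant p a ha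
  obtain ⟨hb1, hb2⟩ := h.screen_invariant p b hb
  rw [← D.screen_sup p, map_add]
  refine ⟨Submodule.add_mem_sup ha1 hb1, fun i hi => ?_⟩
  rw [map_add, map_add]
  exact ⟨Submodule.add_mem_sup (ha2 i hi).1 (hb2 i hi).1,
    Submodule.add_mem_sup (ha2 i hi).2 (hb2 i hi).2⟩

/-- The ambient derivative of a tangent field of a quaternion null submanifold is tangent. -/
theorem IsQuaternionNull.ambientCov_mem_tangent [FiniteDimensional ℂ E] [IsManifold (𝓡 m) 1 N]
    (h : C.IsQuaternionNull D) (hC : C.IsNormal) {O : Set N} (hO : IsOpen O) {p : N} (hp : p ∈ O)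
    (X : Π p : N, TangentSpace (𝓡 m) p) {Y : Π p : N, TangentSpace (𝓡 m) p}
    (hY : VField.SmoothOn ∞ Y O) :
    ScreenData.ambientCov C.g f X Y p ∈ tangent m f p := by
  have : FiniteDimensional ℝ E := FiniteDimensional.complexToReal E
  have : FiniteDimensional ℝ (TangentSpace 𝓘(ℝ, E) (f p)) :=
    inferInstanceAs (FiniteDimensional ℝ E)
  rw [← LinearMap.BilinForm.orthogonal_orthogonal (C.g.bilin_nondegenerate (f p))
    (C.g.bilin_isRefl (f p)) (tangent m f p)]
  intro w hw
  refine C.g.bilin_isRefl (f p) _ _ ?_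
  have hcov : f p ∈ ⋃ i, C.O i := C.cover ▸ mem_univ _
  obtain ⟨i, hi⟩ := mem_iUnion.1 hcov
  have hf := h.null.smooth
  have hF0 := chartMap_self (E := E) (P := EuclideanSpace ℝ (Fin m)) f p
  refine val_ambientCov_eq_zero hf h.null.immersion hO hp X hY hw fun a b => ?_
  have hc := contDiffAt_chartMap hf p
  rw [← hF0]
  refine NormalJet.second_fundamental_form_eq_zero (by rw [hF0]; exact hC.normalJet hi)
    (by rw [hF0]; exact hC.normalJet_rotate hi) (hc.of_le ENat.LEInfty.out)
    (eventually_injective_fderiv_chartMap hf h.null.immersion p).self_of_nhds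
    (eventually_chartVec_mem_range hf (C.isOpen i) hi fun q hq => h.U_mem q i hq)
    (eventually_chartVec_mem_range hf (C.isOpen i) hi fun q hq => h.V_mem q i hq)
    (eventually_chartEnd_mem_range hf (C.isOpen i) hi fun q hq v =>
      ((h.tangent_invariant q _ ⟨v, rfl⟩).2 i hq).1)
    (eventually_chartEnd_mem_range hf (C.isOpen i) hi fun q hq v =>
      ((h.tangent_invariant q _ ⟨v, rfl⟩).2 i hq).2) a b fun x => ?_
  rw [hF0]
  have hd0 := fderiv_chartMap_self hf p x
  exact (congrArg (fun v : E => chartMetric (f p) C.g (extChartAt 𝓘(ℝ, E) (f p) (f p)) v w)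
      hd0).trans ((chartMetric_self _ C.g _ _).trans (hw _ ⟨x, rfl⟩))

end ComplexContactMetricStructure

end Geodesic

end NullContact

theorem mainTheorem1
    {E : Type*} [NormedAddCommGroup E] [NormedSpace ℂ E] [FiniteDimensional ℂ E]
    {M : Type*} [TopologicalSpace M] [ChartedSpace E M] [IsManifold 𝓘(ℂ, E) ω M]
    {n q : ℕ} (hq : 0 < q) (hqn : q < n) {ι : Type*}
    (C : NullContact.ComplexContactMetricStructure E M n ι)
    (hindex : C.g.HasIndex (4 * q)) (hnormal : C.IsNormal)
    {m r : ℕ} {N : Type*} [TopologicalSpace N] [ChartedSpace (EuclideanSpace ℝ (Fin m)) N]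
    [IsManifold (𝓡 m) ∞ N] (f : N → M) (D : NullContact.ScreenData m C.g f r)
    (hquat : C.IsQuaternionNull D) :
    D.TotallyGeodesic := by
  intro O hO X Y hX hY p hp
  have h := hquat.ambientCov_mem_tangent hnormal hO hp X hY
  exact ⟨(Submodule.projection_apply_eq_zero_iff _).2 (Submodule.mem_sup_left h),
    (Submodule.projection_apply_eq_zero_iff _).2 (Submodule.mem_sup_left h)⟩
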